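/- Let $n$ be a non-negative integer and let $\Delta$ be an upward equilateral triangle of side length $n$, divided by the triangular grid into $n^2$ unit triangles. A *fine mixed subdivision* of $\Delta$ is a partition of $\Delta$ into $n$ upward unit triangles of the grid (its *holes*) and $\binom n2$ unit rhombi, each the union of two unit triangles of the grid that share an edge. A set $S$ of $n$ upward unit triangles of the grid in $\Delta$ is *spread-out* if, for every $k$, every upward grid-aligned triangle of side length $k$ in $\Delta$ contains at most $k$ elements of $S$. A polyhedral subdivision of $\Delta$ is *regular* if there is a polytope $P\subset\mathbb{R}^2\times\mathbb{R}$ projecting onto $\Delta$ such that the full-dimensional cells of the subdivision are exactly the two-dimensional projections to $\mathbb{R}^2$ of the lower faces of $P$; here a lower face of $P$ is the set of points of $P$ minimizing a linear functional $(p,h)\mapsto \ell(p)+h$ with $\ell:\mathbb{R}^2\to\mathbb{R}$ linear. **Proposition.** Let $S$ be a spread-out set of $n$ upward unit triangles in $\Delta$. If there is exactly one fine mixed subdivision of $\Delta$ whose set of holes is $S$, then this subdivision is regular. -/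

import Mathlib

namespace HoleyTriangle

/-- The Euclidean plane, in Cartesian coordinates. -/
abbrev Plane : Type := ℝ × ℝ

/-- The vertex of the triangular grid with lattice coordinates `v`, with respect to the unit vectors
`(1, 0)` and `(1/2, √3/2)`, which enclose an angle of 60 degrees. -/
noncomputable def gridPoint (v : ℕ × ℕ) : Plane :=
  ((v.1 : ℝ) + (v.2 : ℝ) / 2, Real.sqrt 3 / 2 * (v.2 : ℝ))

/-- The unit triangles of the grid. The lattice vertices of `up a b` are
`(a, b), (a + 1, b), (a, b + 1)`; those of `down a b` are `(a + 1, b), (a, b + 1), (a + 1, b + 1)`. -/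
inductive UnitTriangle : Type
  | up (a b : ℕ) : UnitTriangle
  | down (a b : ℕ) : UnitTriangle

/-- The three vertices of a unit triangle, in lattice coordinates. -/
def UnitTriangle.vertices : UnitTriangle → Finset (ℕ × ℕ)
  | .up a b => {(a, b), (a + 1, b), (a, b + 1)}
  | .down a b => {(a + 1, b), (a, b + 1), (a + 1, b + 1)}

/-- The unit triangle points upward. -/
def UnitTriangle.IsUp : UnitTriangle → Prop
  | .up _ _ => True
  | .down _ _ => False

/-- The closed region of the plane that a unit triangle occupies. -/
noncomputable def UnitTriangle.region (t : UnitTriangle) : Set Plane :=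
  convexHull ℝ (gridPoint '' (t.vertices : Set (ℕ × ℕ)))

/-- The closed upward grid-aligned triangle of side length `k` whose lower left corner has lattice
coordinates `(a, b)`. -/
noncomputable def upwardTriangle (a b k : ℕ) : Set Plane :=
  convexHull ℝ (gridPoint '' ({(a, b), (a + k, b), (a, b + k)} : Set (ℕ × ℕ)))

/-- The unit triangle `t` lies in the upward grid-aligned triangle of side length `k` with lower left
corner `(a, b)`: all three vertices of `t` do. -/
def UnitTriangle.Inside (a b k : ℕ) (t : UnitTriangle) : Prop :=
  ∀ v ∈ t.vertices, a ≤ v.1 ∧ b ≤ v.2 ∧ v.1 + v.2 ≤ a + b + k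

/-- `S` is a set of `n` upward unit triangles of the grid inside the upward triangle of side `n`. -/
def IsHoleArrangement (n : ℕ) (S : Set UnitTriangle) : Prop :=
  S.ncard = n ∧ ∀ t ∈ S, t.IsUp ∧ t.Inside 0 0 n

/-- Every upward grid-aligned triangle of size `k` (inside the one of size `n`) contains at most `k`
elements of `S`. -/
def IsSpreadOut (n : ℕ) (S : Set UnitTriangle) : Prop :=
  ∀ a b k : ℕ, a + b + k ≤ n → {t | t ∈ S ∧ t.Inside a b k}.ncard ≤ k

/-- The tile `c`, given as a set of unit triangles, is a single upward unit triangle. -/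
def IsUpTile (c : Set UnitTriangle) : Prop :=
  ∃ t : UnitTriangle, t.IsUp ∧ c = {t}

/-- The tile `c`, given as a set of unit triangles, is a unit rhombus: it consists of two unit
triangles with a common edge, that is, with exactly two common vertices. -/
def IsRhombus (c : Set UnitTriangle) : Prop :=
  ∃ s t : UnitTriangle, (s.vertices ∩ t.vertices).card = 2 ∧ c = {s, t}

/-- The closed region of the plane that a tile occupies. -/
noncomputable def tileRegion (c : Set UnitTriangle) : Set Plane :=
  ⋃ t ∈ c, t.region

/-- `C` is (the set of tiles of) a fine mixed subdivision of the upward triangle of side length `n`: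
a partition into `n` upward unit triangles and `n.choose 2` unit rhombi. -/
structure IsFineMixedSubdivision (n : ℕ) (C : Set (Set UnitTriangle)) : Prop where
  tile : ∀ c ∈ C, IsUpTile c ∨ IsRhombus c
  inside : ∀ c ∈ C, ∀ t ∈ c, t.Inside 0 0 n
  partition : ∀ t : UnitTriangle, t.Inside 0 0 n → ∃! c : Set UnitTriangle, c ∈ C ∧ t ∈ c
  card_upTile : {c | c ∈ C ∧ IsUpTile c}.ncard = n
  card_rhombus : {c | c ∈ C ∧ IsRhombus c}.ncard = n.choose 2

/-- The holes of a fine mixed subdivision: its tiles that are single unit triangles. -/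
def holes (C : Set (Set UnitTriangle)) : Set UnitTriangle :=
  {t | {t} ∈ C}

/-- A (convex) polytope in space, the last coordinate of `Plane × ℝ` being the height. -/
def IsPolytope (P : Set (Plane × ℝ)) : Prop :=
  ∃ V : Set (Plane × ℝ), V.Finite ∧ P = convexHull ℝ V

/-- `F` is a lower face of `P`: the set of points of `P` at which some linear functional
`(p, h) ↦ l p + h`, with positive coefficient at the height, is minimal over `P`. -/
def IsLowerFace (P F : Set (Plane × ℝ)) : Prop :=
  ∃ l : Plane →ₗ[ℝ] ℝ, F = {z | z ∈ P ∧ ∀ w ∈ P, l z.1 + z.2 ≤ l w.1 + w.2}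

/-- The polyhedral subdivision of `Q` with the set `cells` of full-dimensional cells is regular: some
polytope projects onto `Q`, and the two-dimensional projections of its lower faces are exactly the
given cells. (The lower-dimensional cells are the faces of these.) -/
def IsRegular (Q : Set Plane) (cells : Set (Set Plane)) : Prop :=
  ∃ P : Set (Plane × ℝ), IsPolytope P ∧ Prod.fst '' P = Q ∧
    cells = {c | (∃ F : Set (Plane × ℝ), IsLowerFace P F ∧ c = Prod.fst '' F) ∧
      (interior c).Nonempty}

end HoleyTriangle

/-! Regularity asks for heights on the grid points whose interpolation is convex, flat across the
short diagonal of each rhombus and strictly bent across every other interior edge. The bends are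
rhombus differences. Nonnegative bends, no two vanishing at the same down triangle, already give
global support functions (`IsHive.nonneg`, `exists_support`), and these yield the polytope
(`isRegular_of_supporting`). Edge weights that are balanced at every interior vertex are the bends
of some height function (`exists_rhombus_differences`). So it suffices to find balanced weights that
vanish on the short diagonals and are positive on all other interior edges.

By Stiemke's alternative such weights exist unless some nonzero vector field on the grid, zero at
the boundary, contracts no edge except possibly short diagonals (`exists_balanced_weights`). Given
such a field, leave each vertex of nonzero vector along an edge that has positive inner product with
it. The product stays positive at the far end, so the walk never reaches the boundary. The edge can
be chosen so that it is no short diagonal and the walk never turns sharply around an up triangle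
(`exists_direction`). By finiteness this produces disjoint closed walks (`exists_closed_walks`).

Consider their winding numbers. The two halves of a rhombus have the same number, because no walk
uses the short diagonal. An up triangle has at most one side on the walks, so one of nonzero winding
number shares that number with at least two down neighbours. Hence from a down triangle of nonzero
winding number one can pass to its partner and on to a different such down triangle. This closes up
to an alternating cycle, and flipping it gives a second subdivision with the same holes
(`not_exists_alternating`), against uniqueness. -/

namespace HoleyTriangle

/-! ### A theorem of the alternative -/

/-- Stiemke's alternative: a space of vectors with no nonzero nonnegative member is orthogonal to
some positive vector. -/
theorem exists_pos_orthogonal {ι : Type*} (s : Finset ι) (L : Submodule ℝ (ι → ℝ))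
    (h : ∀ c ∈ L, (∀ i ∈ s, 0 ≤ c i) → ∀ i ∈ s, c i = 0) :
    ∃ w : ι → ℝ, (∀ i ∈ s, 0 < w i) ∧ (∀ i, i ∉ s → w i = 0) ∧
      ∀ c ∈ L, ∑ i ∈ s, w i * c i = 0 := by
  classical
  let res : (ι → ℝ) →ₗ[ℝ] (s → ℝ) := LinearMap.funLeft ℝ ℝ Subtype.val
  let L' : Submodule ℝ (s → ℝ) := L.map res
  have hdisj : Disjoint (stdSimplex ℝ s) (L' : Set (s → ℝ)) := by
    rw [Set.disjoint_left]
    rintro x ⟨hx0, hx1⟩ ⟨c, hc, rfl⟩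
    have hz := h c hc (fun i hi => hx0 ⟨i, hi⟩)
    have : ∑ i : s, res c i = 0 := Finset.sum_eq_zero fun i _ => hz i.1 i.2
    rw [this] at hx1
    exact zero_ne_one hx1
  -- Separation puts `φ` below `u < v` on the simplex and above `v` on the subspace. As the subspace
  -- contains `0`, `v` is negative, so `-φ` is positive on the basis vectors and supplies the
  -- weights.
  obtain ⟨φ, u, v, h1, h2, h3⟩ := geometric_hahn_banach_compact_closed
    (convex_stdSimplex ℝ s) (isCompact_stdSimplex ℝ s) L'.convex
    L'.closed_of_finiteDimensional hdisj
  have hv : v < 0 := by simpa using h3 0 L'.zero_mem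
  -- A functional bounded below on a subspace vanishes there: otherwise a multiple of `b` has value
  -- exactly `v`.
  have hzero : ∀ b ∈ L', φ b = 0 := by
    intro b hb
    by_contra hne
    have := h3 ((v / φ b) • b) (L'.smul_mem _ hb)
    rw [map_smul, smul_eq_mul, div_mul_cancel₀ _ hne] at this
    exact lt_irrefl _ this
  refine ⟨fun i => if hi : i ∈ s then -φ (Pi.single ⟨i, hi⟩ 1) else 0, ?_, ?_, ?_⟩
  · intro i hi
    have := h1 _ (single_mem_stdSimplex ℝ (⟨i, hi⟩ : s))
    simp only [hi, dif_pos]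
    linarith
  · intro i hi
    simp [hi]
  · intro c hc
    have h0 := hzero (res c) ⟨c, hc, rfl⟩
    have hexp : res c = ∑ i : s, c i • Pi.single (M := fun _ : s => ℝ) i 1 := by
      ext j
      simp [res, Finset.sum_apply, Pi.single_apply]
    rw [hexp, map_sum] at h0
    rw [← Finset.sum_coe_sort]
    have : ∑ i : s, (if hi : (i : ι) ∈ s then -φ (Pi.single ⟨i, hi⟩ 1) else 0) * c i
        = -∑ i : s, φ (c i • Pi.single (M := fun _ : s => ℝ) i 1) := by
      rw [← Finset.sum_neg_distrib]
      refine Finset.sum_congr rfl fun i _ => ?_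
      simp [mul_comm]
    rw [this, h0, neg_zero]

/-! ### Regularity from support functions -/

/-- The part of a convex hull on which a functional attains its minimum `m` is spanned by the
generators on which it does. -/
theorem convexHull_face {W : Set (Plane × ℝ)} {l : Plane →ₗ[ℝ] ℝ} {m : ℝ}
    (hm : ∀ z ∈ W, m ≤ l z.1 + z.2) {z : Plane × ℝ} (hz : z ∈ convexHull ℝ W) :
    m ≤ l z.1 + z.2 ∧
      (l z.1 + z.2 = m → z ∈ convexHull ℝ {w | w ∈ W ∧ l w.1 + w.2 = m}) := by
  have hconv : Convex ℝ {z : Plane × ℝ | m ≤ l z.1 + z.2 ∧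
      (l z.1 + z.2 = m → z ∈ convexHull ℝ {w | w ∈ W ∧ l w.1 + w.2 = m})} := by
    rintro x ⟨hx1, hx2⟩ y ⟨hy1, hy2⟩ a b ha hb hab
    have hval : l (a • x + b • y).1 + (a • x + b • y).2
        = a * (l x.1 + x.2) + b * (l y.1 + y.2) := by
      simp only [Prod.fst_add, Prod.smul_fst, Prod.snd_add, Prod.smul_snd, map_add, map_smul,
        smul_eq_mul]
      ring
    have hm' : a * m + b * m = m := by rw [← add_mul, hab, one_mul]
    have hax := mul_le_mul_of_nonneg_left hx1 ha
    have hby := mul_le_mul_of_nonneg_left hy1 hb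
    refine ⟨by rw [hval]; linarith, fun heq => ?_⟩
    rw [hval] at heq
    rcases ha.eq_or_lt with rfl | ha'
    · obtain rfl : b = 1 := by linarith
      simpa using hy2 (by linarith)
    rcases hb.eq_or_lt with rfl | hb'
    · obtain rfl : a = 1 := by linarith
      simpa using hx2 (by linarith)
    have ex : l x.1 + x.2 = m := mul_left_cancel₀ ha'.ne' (by linarith)
    have ey : l y.1 + y.2 = m := mul_left_cancel₀ hb'.ne' (by linarith)
    exact convex_convexHull ℝ _ (hx2 ex) (hy2 ey) ha hb hab
  have hsub : W ⊆ {z : Plane × ℝ | m ≤ l z.1 + z.2 ∧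
      (l z.1 + z.2 = m → z ∈ convexHull ℝ {w | w ∈ W ∧ l w.1 + w.2 = m})} :=
    fun w hw => ⟨hm w hw, fun h => subset_convexHull ℝ _ ⟨hw, h⟩⟩
  exact convexHull_min hsub hconv hz

/-- Finitely many convex tiles covering `Q` form a regular subdivision if the heights of the
vertices have, for each tile, an affine support function that is tight exactly at its vertices. -/
theorem isRegular_of_supporting {ι : Type*} {V : Set ι} (hV : V.Finite) (pos : ι → Plane)
    (f : ι → ℝ) (T : Set (Set ι)) (hsub : ∀ τ ∈ T, τ ⊆ V)
    (hsupp : ∀ τ ∈ T, ∃ (l : Plane →ₗ[ℝ] ℝ) (m : ℝ), ∀ v ∈ V, m ≤ l (pos v) + f v ∧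
      (l (pos v) + f v = m ↔ v ∈ τ))
    (hint : ∀ τ ∈ T, (interior (convexHull ℝ (pos '' τ))).Nonempty)
    (hcov : interior (convexHull ℝ (pos '' V)) ⊆ ⋃ τ ∈ T, convexHull ℝ (pos '' τ)) :
    IsRegular (convexHull ℝ (pos '' V)) ((fun τ => convexHull ℝ (pos '' τ)) '' T) := by
  set lift : ι → Plane × ℝ := fun v => (pos v, f v) with hlift
  set P : Set (Plane × ℝ) := convexHull ℝ (lift '' V) with hP
  have hfst : ∀ W : Set ι, Prod.fst '' convexHull ℝ (lift '' W) = convexHull ℝ (pos '' W) := by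
    intro W
    have := (LinearMap.fst ℝ Plane ℝ).image_convexHull (lift '' W)
    rw [Set.image_image] at this
    simpa [hlift] using this
  have hup : ∀ τ ∈ T, ∀ (l : Plane →ₗ[ℝ] ℝ) (m : ℝ),
      (∀ v ∈ V, m ≤ l (pos v) + f v ∧ (l (pos v) + f v = m ↔ v ∈ τ)) →
      ∀ x ∈ convexHull ℝ (pos '' τ), (x, m - l x) ∈ P := by
    intro τ hτ l m hlm x hx
    have hconv : Convex ℝ {x : Plane | (x, m - l x) ∈ P} := by
      intro x hx y hy a b ha hb hab
      have := convex_convexHull ℝ (lift '' V) hx hy ha hb hab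
      have hh : m - l (a • x + b • y) = a * (m - l x) + b * (m - l y) := by
        simp only [map_add, map_smul, smul_eq_mul]
        linear_combination (-m) * hab
      simp only [Set.mem_ofPred_eq, hh]
      simpa using this
    refine convexHull_min ?_ hconv hx
    rintro _ ⟨v, hv, rfl⟩
    have h2 := (hlm v (hsub τ hτ hv)).2.2 hv
    have : lift v = (pos v, m - l (pos v)) := by
      simp only [hlift, Prod.mk.injEq, true_and]
      linarith
    simp only [Set.mem_ofPred_eq, ← this]
    exact subset_convexHull ℝ _ ⟨v, hsub τ hτ hv, rfl⟩
  have hproj : ∀ τ ∈ T, ∀ (l : Plane →ₗ[ℝ] ℝ) (m : ℝ),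
      (∀ v ∈ V, m ≤ l (pos v) + f v ∧ (l (pos v) + f v = m ↔ v ∈ τ)) →
      Prod.fst '' {z | z ∈ P ∧ ∀ w ∈ P, l z.1 + z.2 ≤ l w.1 + w.2}
        = convexHull ℝ (pos '' τ) := by
    intro τ hτ l m hlm
    have hW : ∀ z ∈ lift '' V, m ≤ l z.1 + z.2 := by
      rintro _ ⟨v, hv, rfl⟩
      exact (hlm v hv).1
    apply Set.Subset.antisymm
    · rintro _ ⟨z, ⟨hz, hmin⟩, rfl⟩
      obtain ⟨x, hx⟩ := (hint τ hτ)
      have h1 := hmin _ (hup τ hτ l m hlm x (interior_subset hx))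
      have h2 := convexHull_face hW hz
      have h3 := h2.2 (by simp only at h1; linarith [h2.1])
      rw [← hfst]
      refine ⟨z, convexHull_mono ?_ h3, rfl⟩
      rintro _ ⟨⟨v, hv, rfl⟩, he⟩
      exact ⟨v, (hlm v hv).2.1 he, rfl⟩
    · intro x hx
      refine ⟨(x, m - l x), ⟨hup τ hτ l m hlm x hx, fun w hw => ?_⟩, rfl⟩
      have := (convexHull_face hW hw).1
      simpa using this
  refine ⟨P, ⟨lift '' V, hV.image _, rfl⟩, hfst V, ?_⟩
  apply Set.Subset.antisymm
  · rintro _ ⟨τ, hτ, rfl⟩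
    obtain ⟨l, m, hlm⟩ := hsupp τ hτ
    exact ⟨⟨_, ⟨l, rfl⟩, (hproj τ hτ l m hlm).symm⟩, hint τ hτ⟩
  · rintro _ ⟨⟨F, ⟨l, rfl⟩, rfl⟩, y₀, hy₀⟩
    set c := Prod.fst '' {z | z ∈ P ∧ ∀ w ∈ P, l z.1 + z.2 ≤ l w.1 + w.2} with hc
    have hcQ : c ⊆ convexHull ℝ (pos '' V) := by
      rw [← hfst V]
      exact Set.image_mono fun z hz => hz.1
    obtain ⟨τ, hτ, hyτ⟩ : ∃ τ ∈ T, y₀ ∈ convexHull ℝ (pos '' τ) := by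
      simpa using hcov (interior_mono hcQ hy₀)
    obtain ⟨l', m', hlm⟩ := hsupp τ hτ
    -- The tile lies in the closure of its interior, so the interior of the projected face, a
    -- neighbourhood of `y₀`, meets the interior of the tile.
    have hcl : y₀ ∈ closure (interior (convexHull ℝ (pos '' τ))) := by
      rw [(convex_convexHull ℝ _).closure_interior_eq_closure_of_nonempty_interior (hint τ hτ)]
      exact subset_closure hyτ
    obtain ⟨y, hyc, hyt⟩ := mem_closure_iff.1 hcl _ isOpen_interior hy₀
    obtain ⟨z, ⟨hzP, hzmin⟩, hzy⟩ := interior_subset hyc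
    have hW : ∀ z ∈ lift '' V, m' ≤ l' z.1 + z.2 := by
      rintro _ ⟨v, hv, rfl⟩
      exact (hlm v hv).1
    have hz1 := (convexHull_face hW hzP).1
    have hK : ∀ x ∈ convexHull ℝ (pos '' τ), l z.1 + z.2 ≤ l x + (m' - l' x) :=
      fun x hx => hzmin _ (hup τ hτ l' m' hlm x hx)
    -- Over the tile the lower boundary of `P` is `m' - l'`. Minimality of `z` therefore makes `l -
    -- l'` minimal over the tile at the interior point `y`, which forces this linear functional to
    -- be zero.
    have hll : l = l' := by
      refine LinearMap.ext fun e => ?_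
      · have hlim : ∀ᶠ t : ℝ in nhds 0, y + t • e ∈ convexHull ℝ (pos '' τ) := by
          have hcont : Filter.Tendsto (fun t : ℝ => y + t • e) (nhds 0) (nhds y) := by
            have : Continuous (fun t : ℝ => y + t • e) := by fun_prop
            simpa using this.tendsto 0
          exact hcont (mem_interior_iff_mem_nhds.1 hyt)
        obtain ⟨ε, hε, hball⟩ := Metric.eventually_nhds_iff.1 hlim
        have hp := hK _ (hball (y := ε / 2) (by rw [Real.dist_eq, sub_zero, abs_of_pos] <;> linarith))
        have hn := hK _ (hball (y := -(ε / 2))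
          (by rw [Real.dist_eq, sub_zero, abs_neg, abs_of_pos] <;> linarith))
        simp only [map_add, map_smul, smul_eq_mul, hzy] at hp hn hz1
        nlinarith
    refine ⟨τ, hτ, ?_⟩
    subst hll
    exact (hproj τ hτ l m' hlm).symm

/-! ### Triangles and parallelograms as convex hulls -/

theorem mem_convexHull_triangle {E : Type*} [AddCommGroup E] [Module ℝ E] {A B C : E}
    {a b c : ℝ} (ha : 0 ≤ a) (hb : 0 ≤ b) (hc : 0 ≤ c) (hs : a + b + c = 1) :
    a • A + b • B + c • C ∈ convexHull ℝ {A, B, C} := by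
  have := (convex_convexHull ℝ {A, B, C}).sum_mem (t := Finset.univ) (w := ![a, b, c])
    (z := ![A, B, C]) ?_ ?_ ?_
  · simpa [Fin.sum_univ_three] using this
  · intro i _
    fin_cases i <;> simpa
  · simpa [Fin.sum_univ_three] using hs
  · intro i _
    apply subset_convexHull
    fin_cases i <;> simp

/-- A parallelogram is the union of the two triangles into which a diagonal cuts it. -/
theorem convexHull_parallelogram {E : Type*} [AddCommGroup E] [Module ℝ E] {A B C D : E}
    (h : A + D = B + C) :
    convexHull ℝ {A, B, C, D} = convexHull ℝ {A, B, C} ∪ convexHull ℝ {D, B, C} := by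
  apply Set.Subset.antisymm
  · have hconv : Convex ℝ {x : E | ∃ a b c d : ℝ, 0 ≤ a ∧ 0 ≤ b ∧ 0 ≤ c ∧ 0 ≤ d ∧
        a + b + c + d = 1 ∧ x = a • A + b • B + c • C + d • D} := by
      rintro x ⟨a, b, c, d, ha, hb, hc, hd, hs, rfl⟩ y ⟨a', b', c', d', ha', hb', hc', hd', hs', rfl⟩
        s t hs0 ht0 hst
      refine ⟨s * a + t * a', s * b + t * b', s * c + t * c', s * d + t * d', by positivity,
        by positivity, by positivity, by positivity, ?_, by module⟩
      linear_combination s * hs + t * hs' + hst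
    have hsub : ({A, B, C, D} : Set E) ⊆ {x : E | ∃ a b c d : ℝ, 0 ≤ a ∧ 0 ≤ b ∧ 0 ≤ c ∧ 0 ≤ d ∧
        a + b + c + d = 1 ∧ x = a • A + b • B + c • C + d • D} := by
      rintro x (rfl | rfl | rfl | rfl)
      · exact ⟨1, 0, 0, 0, by simp⟩
      · exact ⟨0, 1, 0, 0, by simp⟩
      · exact ⟨0, 0, 1, 0, by simp⟩
      · exact ⟨0, 0, 0, 1, by simp⟩
    intro x hx
    obtain ⟨a, b, c, d, ha, hb, hc, hd, hs, rfl⟩ := convexHull_min hsub hconv hx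
    -- Trading `min a d` times `A + D` for `B + C` eliminates whichever of `A` and `D` has the
    -- smaller weight.
    rcases le_total d a with hda | had
    · left
      have : a • A + b • B + c • C + d • D = (a - d) • A + (b + d) • B + (c + d) • C := by
        rw [eq_sub_of_add_eq' h]
        module
      rw [this]
      exact mem_convexHull_triangle (by linarith) (by linarith) (by linarith) (by linarith)
    · right
      have : a • A + b • B + c • C + d • D = (d - a) • D + (b + a) • B + (c + a) • C := by
        rw [eq_sub_of_add_eq' h]
        module
      rw [this]
      exact mem_convexHull_triangle (by linarith) (by linarith) (by linarith) (by linarith)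
  · refine Set.union_subset (convexHull_mono ?_) (convexHull_mono ?_)
    · intro x
      simp only [Set.mem_insert_iff, Set.mem_singleton_iff]
      tauto
    · intro x
      simp only [Set.mem_insert_iff, Set.mem_singleton_iff]
      tauto

/-! ### Hives -/

/-- The difference of a function on a triangular grid, given in barycentric coordinates, over the
rhombus whose short diagonal is the side of the down triangle `(i, j, k)` opposite to the third
coordinate axis. -/
def rhombusDiff (g : ℕ → ℕ → ℕ → ℝ) (i j k : ℕ) : ℝ :=
  g i j (k + 2) + g (i + 1) (j + 1) k - g (i + 1) j (k + 1) - g i (j + 1) (k + 1)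

/-- Cyclic rotation of the barycentric coordinates. -/
def rotate (g : ℕ → ℕ → ℕ → ℝ) : ℕ → ℕ → ℕ → ℝ := fun i j k => g j k i

/-- The rhombus difference at `(i, j, k)` along the second coordinate axis. -/
def rhombusDiff₂ (g : ℕ → ℕ → ℕ → ℝ) (i j k : ℕ) : ℝ :=
  g i (j + 2) k + g (i + 1) j (k + 1) - g i (j + 1) (k + 1) - g (i + 1) (j + 1) k

/-- The rhombus difference at `(i, j, k)` along the first coordinate axis. -/
def rhombusDiff₁ (g : ℕ → ℕ → ℕ → ℝ) (i j k : ℕ) : ℝ :=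
  g (i + 2) j k + g i (j + 1) (k + 1) - g (i + 1) j (k + 1) - g (i + 1) (j + 1) k

/-- A hive: all rhombus differences are nonnegative; moreover no two at the same down triangle
vanish. -/
def IsHive (n : ℕ) (g : ℕ → ℕ → ℕ → ℝ) : Prop :=
  ∀ i j k, i + j + k + 2 = n →
    (0 ≤ rhombusDiff g i j k ∧ 0 ≤ rhombusDiff₂ g i j k ∧ 0 ≤ rhombusDiff₁ g i j k) ∧
    0 < rhombusDiff g i j k + rhombusDiff₂ g i j k ∧
    0 < rhombusDiff₂ g i j k + rhombusDiff₁ g i j k ∧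
    0 < rhombusDiff₁ g i j k + rhombusDiff g i j k

theorem IsHive.rotate {n : ℕ} {g : ℕ → ℕ → ℕ → ℝ} (hg : IsHive n g) :
    IsHive n (rotate g) := by
  intro i j k h
  obtain ⟨⟨h1, h2, h3⟩, h4, h5, h6⟩ := hg j k i (by omega)
  simp only [rhombusDiff, rhombusDiff₂, rhombusDiff₁, HoleyTriangle.rotate] at *
  refine ⟨⟨?_, ?_, ?_⟩, ?_, ?_, ?_⟩ <;> linarith

/-- The mixed second differences telescope over the rectangle with sides `S` and `T`. -/
theorem add_le_of_mixed_difference_nonneg {q : ℕ → ℕ → ℝ} {S T : ℕ}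
    (h : ∀ s t, s < S → t < T → q (s + 1) t + q s (t + 1) ≤ q (s + 1) (t + 1) + q s t) :
    q S 0 + q 0 T ≤ q S T + q 0 0 := by
  have h1 : ∀ t, t < T → ∀ s, s ≤ S → q s t + q 0 (t + 1) ≤ q s (t + 1) + q 0 t := by
    intro t ht s
    induction s with
    | zero => intro _; linarith
    | succ s ih =>
      intro hs
      linarith [ih (by omega), h s t (by omega) ht]
  have h2 : ∀ t, t ≤ T → q S 0 + q 0 t ≤ q S t + q 0 0 := by
    intro t
    induction t with
    | zero => intro _; linarith
    | succ t ih =>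
      intro ht
      linarith [ih (by omega), h1 t (by omega) S le_rfl]
  exact h2 T le_rfl

theorem pos_of_strictly_convex {u : ℕ → ℝ} {N : ℕ} (h0 : u 0 = 0) (h1 : u 1 = 0)
    (h : ∀ s, s + 2 ≤ N → 2 * u (s + 1) < u (s + 2) + u s) :
    ∀ s, s + 2 ≤ N → 0 < u (s + 2) := by
  have key : ∀ s, s + 2 ≤ N → 0 < u (s + 2) ∧ u (s + 1) ≤ u (s + 2) := by
    intro s
    induction s with
    | zero =>
      intro hs
      have := h 0 hs
      simp only [zero_add] at *
      constructor <;> linarith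
    | succ s ih =>
      intro hs
      have := h (s + 1) hs
      obtain ⟨h2, h3⟩ := ih (by omega)
      simp only [add_assoc, Nat.reduceAdd] at *
      constructor <;> linarith
  exact fun s hs => (key s hs).1

section Cone

variable {n : ℕ} {g : ℕ → ℕ → ℕ → ℝ} {a b c : ℕ}

/-- This is the cone with apex `A` spanned by the sides `AB` and `AC`. Along each ray a second
difference is the sum of two rhombus differences at one down triangle, hence positive, so `g` is
positive on the ray beyond the first step. Inside the cone `rhombusDiff` is the mixed second
difference, so `g` is at least the sum of its values at the two projections to the rays. -/
theorem IsHive.cone (hg : IsHive n g) (hn : a + b + c + 1 = n) (hA : g a b (c + 1) = 0)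
    (hB : g (a + 1) b c = 0) (hC : g a (b + 1) c = 0) {s t z : ℕ}
    (hz : a + s + (b + t) + z = n) :
    0 ≤ g (a + s) (b + t) z ∧ (g (a + s) (b + t) z = 0 → s ≤ 1 ∧ t ≤ 1) := by
  have hs : ∀ s, s + 2 ≤ c + 1 → 0 < g (a + (s + 2)) b (c + 1 - (s + 2)) := by
    refine pos_of_strictly_convex (u := fun s => g (a + s) b (c + 1 - s)) (N := c + 1) hA
      (by simpa using hB) fun s hs => ?_
    have := (hg (a + s) b (c + 1 - (s + 2)) (by omega)).2.2.2
    simp only [rhombusDiff, rhombusDiff₁] at this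
    rw [show c + 1 - s = c + 1 - (s + 2) + 2 by omega,
      show c + 1 - (s + 1) = c + 1 - (s + 2) + 1 by omega]
    simp only [← add_assoc] at *
    linarith
  have ht : ∀ t, t + 2 ≤ c + 1 → 0 < g a (b + (t + 2)) (c + 1 - (t + 2)) := by
    refine pos_of_strictly_convex (u := fun t => g a (b + t) (c + 1 - t)) (N := c + 1) hA
      (by simpa using hC) fun t ht => ?_
    have := (hg a (b + t) (c + 1 - (t + 2)) (by omega)).2.1
    simp only [rhombusDiff, rhombusDiff₂] at this
    rw [show c + 1 - t = c + 1 - (t + 2) + 2 by omega,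
      show c + 1 - (t + 1) = c + 1 - (t + 2) + 1 by omega]
    simp only [← add_assoc] at *
    linarith
  have hmix := add_le_of_mixed_difference_nonneg
    (q := fun s t => g (a + s) (b + t) (c + 1 - (s + t))) (S := s) (T := t) fun s' t' h1 h2 => by
      have := (hg (a + s') (b + t') (c + 1 - (s' + t' + 2)) (by omega)).1.1
      simp only [rhombusDiff] at this
      simp only [← add_assoc]
      rw [show c + 1 - (s' + t') = c + 1 - (s' + t' + 2) + 2 by omega,
        show c + 1 - (s' + 1 + t') = c + 1 - (s' + t' + 2) + 1 by omega,
        show c + 1 - (s' + t' + 1) = c + 1 - (s' + t' + 2) + 1 by omega,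
        show c + 1 - (s' + 1 + t' + 1) = c + 1 - (s' + t' + 2) by omega]
      linarith
  simp only [add_zero, zero_add, Nat.sub_zero, hA] at hmix
  rw [show c + 1 - (s + t) = z by omega] at hmix
  have hs' : 0 ≤ g (a + s) b (c + 1 - s) ∧ (2 ≤ s → 0 < g (a + s) b (c + 1 - s)) := by
    rcases s with _ | _ | s
    · simp [hA]
    · simp [hB]
    · exact ⟨(hs s (by omega)).le, fun _ => hs s (by omega)⟩
  have ht' : 0 ≤ g a (b + t) (c + 1 - t) ∧ (2 ≤ t → 0 < g a (b + t) (c + 1 - t)) := by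
    rcases t with _ | _ | t
    · simp [hA]
    · simp [hC]
    · exact ⟨(ht t (by omega)).le, fun _ => ht t (by omega)⟩
  refine ⟨by linarith [hs'.1, ht'.1], fun h0 => ⟨?_, ?_⟩⟩
  · by_contra hlt
    linarith [hs'.2 (by omega), ht'.1]
  · by_contra hlt
    linarith [ht'.2 (by omega), hs'.1]

/-- The same argument as for `IsHive.cone`, with the sides prolonged backwards through `A`. The
zeros at `B` and `A`, and at `C` and `A`, now start the two convex sequences, so positivity begins
one step beyond `A`. -/
theorem IsHive.opposite_cone (hg : IsHive n g) (hn : a + b + c + 1 = n)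
    (hA : g a b (c + 1) = 0) (hB : g (a + 1) b c = 0) (hC : g a (b + 1) c = 0) {s t z : ℕ}
    (hs : s ≤ a) (ht : t ≤ b) (hz : a - s + (b - t) + z = n) :
    0 ≤ g (a - s) (b - t) z ∧ (g (a - s) (b - t) z = 0 → s = 0 ∧ t = 0) := by
  have hs1 : ∀ s, s + 2 ≤ a + 1 → 0 < g (a + 1 - (s + 2)) b (c + (s + 2)) := by
    refine pos_of_strictly_convex (u := fun s => g (a + 1 - s) b (c + s)) (N := a + 1) hB
      (by simpa using hA) fun s hs => ?_
    have := (hg (a + 1 - (s + 2)) b (c + s) (by omega)).2.2.2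
    simp only [rhombusDiff, rhombusDiff₁] at this
    rw [show a + 1 - s = a + 1 - (s + 2) + 2 by omega,
      show a + 1 - (s + 1) = a + 1 - (s + 2) + 1 by omega]
    simp only [← add_assoc] at *
    linarith
  have ht1 : ∀ t, t + 2 ≤ b + 1 → 0 < g a (b + 1 - (t + 2)) (c + (t + 2)) := by
    refine pos_of_strictly_convex (u := fun t => g a (b + 1 - t) (c + t)) (N := b + 1) hC
      (by simpa using hA) fun t ht => ?_
    have := (hg a (b + 1 - (t + 2)) (c + t) (by omega)).2.1
    simp only [rhombusDiff, rhombusDiff₂] at this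
    rw [show b + 1 - t = b + 1 - (t + 2) + 2 by omega,
      show b + 1 - (t + 1) = b + 1 - (t + 2) + 1 by omega]
    simp only [← add_assoc] at *
    linarith
  have hmix := add_le_of_mixed_difference_nonneg
    (q := fun s t => g (a - s) (b - t) (c + 1 + (s + t))) (S := s) (T := t) fun s' t' h1 h2 => by
      have := (hg (a - (s' + 1)) (b - (t' + 1)) (c + 1 + (s' + t')) (by omega)).1.1
      simp only [rhombusDiff] at this
      simp only [← add_assoc] at *
      rw [show a - s' = a - (s' + 1) + 1 by omega, show b - t' = b - (t' + 1) + 1 by omega,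
        show c + 1 + s' + 1 + t' = c + 1 + s' + t' + 1 by omega,
        show c + 1 + s' + t' + 1 + 1 = c + 1 + s' + t' + 2 by omega]
      linarith
  simp only [add_zero, zero_add, Nat.sub_zero, hA] at hmix
  rw [show c + 1 + (s + t) = z by omega] at hmix
  have hs' : 0 ≤ g (a - s) b (c + 1 + s) ∧ (1 ≤ s → 0 < g (a - s) b (c + 1 + s)) := by
    rcases s with _ | s
    · simp [hA]
    · have := hs1 s (by omega)
      rw [show a + 1 - (s + 2) = a - (s + 1) by omega,
        show c + (s + 2) = c + 1 + (s + 1) by omega] at this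
      exact ⟨this.le, fun _ => this⟩
  have ht' : 0 ≤ g a (b - t) (c + 1 + t) ∧ (1 ≤ t → 0 < g a (b - t) (c + 1 + t)) := by
    rcases t with _ | t
    · simp [hA]
    · have := ht1 t (by omega)
      rw [show b + 1 - (t + 2) = b - (t + 1) by omega,
        show c + (t + 2) = c + 1 + (t + 1) by omega] at this
      exact ⟨this.le, fun _ => this⟩
  refine ⟨by linarith [hs'.1, ht'.1], fun h0 => ⟨?_, ?_⟩⟩
  · by_contra hlt
    linarith [hs'.2 (by omega), ht'.1]
  · by_contra hlt
    linarith [ht'.2 (by omega), hs'.1]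

/-- A hive that vanishes at the vertices of an up triangle is nonnegative, and positive except at
these vertices and their mirror images in the sides of the triangle. -/
theorem IsHive.nonneg (hg : IsHive n g) (hn : a + b + c + 1 = n) (hA : g a b (c + 1) = 0)
    (hB : g (a + 1) b c = 0) (hC : g a (b + 1) c = 0) {x y z : ℕ} (hz : x + y + z = n) :
    0 ≤ g x y z ∧ (g x y z = 0 → (x = a ∧ y = b) ∨ (x = a + 1 ∧ y = b) ∨ (x = a ∧ y = b + 1) ∨
      (x = a + 1 ∧ y = b + 1) ∨ (x = a + 1 ∧ y + 1 = b) ∨ (x + 1 = a ∧ y = b + 1)) := by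
  have main : ∀ {g : ℕ → ℕ → ℕ → ℝ}, IsHive n g → ∀ {a b c : ℕ}, a + b + c + 1 = n →
      g a b (c + 1) = 0 → g (a + 1) b c = 0 → g a (b + 1) c = 0 → ∀ {x y z : ℕ},
      x + y + z = n → (a ≤ x ∧ b ≤ y ∨ x ≤ a ∧ y ≤ b) →
      0 ≤ g x y z ∧ (g x y z = 0 → a ≤ x ∧ b ≤ y ∧ x ≤ a + 1 ∧ y ≤ b + 1) := by
    intro g hg a b c hn hA hB hC x y z hz h
    rcases h with ⟨h1, h2⟩ | ⟨h1, h2⟩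
    · obtain ⟨s, rfl⟩ := Nat.exists_eq_add_of_le h1
      obtain ⟨t, rfl⟩ := Nat.exists_eq_add_of_le h2
      have := hg.cone hn hA hB hC hz
      refine ⟨this.1, fun h0 => ?_⟩
      have := this.2 h0
      omega
    · have := hg.opposite_cone hn hA hB hC (s := a - x) (t := b - y) (z := z) (by omega)
        (by omega) (by omega)
      rw [show a - (a - x) = x by omega, show b - (b - y) = y by omega] at this
      refine ⟨this.1, fun h0 => ?_⟩
      have := this.2 h0
      omega
  -- Among `x - a`, `y - b`, `z - c` two have the same weak sign, so the double cones at the three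
  -- corners cover the grid. Rotation reduces every corner to the one treated in `main`.
  have hcases : (a ≤ x ∧ b ≤ y ∨ x ≤ a ∧ y ≤ b) ∨ (b ≤ y ∧ c ≤ z ∨ y ≤ b ∧ z ≤ c) ∨
      (c ≤ z ∧ a ≤ x ∨ z ≤ c ∧ x ≤ a) := by omega
  rcases hcases with h | h | h
  · have := main hg hn hA hB hC hz h
    refine ⟨this.1, fun h0 => ?_⟩
    have := this.2 h0
    omega
  · have := main (g := fun i j k => g k i j) hg.rotate.rotate (a := b) (b := c) (c := a) (by omega)
      hB hC hA (x := y) (y := z) (z := x) (by omega) h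
    refine ⟨this.1, fun h0 => ?_⟩
    have := this.2 h0
    omega
  · have := main (g := fun i j k => g j k i) hg.rotate (a := c) (b := a) (c := b) (by omega)
      hC hA hB (x := z) (y := x) (z := y) (by omega) h
    refine ⟨this.1, fun h0 => ?_⟩
    have := this.2 h0
    omega

end Cone

/-! ### Balanced weights -/

/-- Weights on the interior edges of the grid that are balanced at each interior vertex are the
rhombus differences of a function on the grid. The weights `s i j`, `h i j`, `v i j` belong to the
three sides of the down triangle `down i j`. -/
theorem exists_rhombus_differences (n : ℕ) (s h v : ℕ → ℕ → ℝ)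
    (hx : ∀ a b, a + b + 3 ≤ n → h (a + 1) b - h a b - s a (b + 1) + s (a + 1) b = 0)
    (hy : ∀ a b, a + b + 3 ≤ n → v a (b + 1) - v a b + s a (b + 1) - s (a + 1) b = 0) :
    ∃ f : ℕ → ℕ → ℝ, ∀ i j, i + j + 2 ≤ n →
      f i j + f (i + 1) (j + 1) - f (i + 1) j - f i (j + 1) = s i j ∧
      f i (j + 2) + f (i + 1) j - f i (j + 1) - f (i + 1) (j + 1) = h i j ∧
      f (i + 2) j + f i (j + 1) - f (i + 1) j - f (i + 1) (j + 1) = v i j := by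
  -- The weights `s` determine `f` up to its values on the two axes. The second differences of `F`
  -- and `G` are `v + s` and `h + s`, which makes the other two families correct along an axis; the
  -- balance equations carry this inwards.
  set F : ℕ → ℝ := fun a => ∑ i ∈ Finset.range a, ∑ k ∈ Finset.range i, (v k 0 + s k 0) with hF
  set G : ℕ → ℝ := fun b => ∑ i ∈ Finset.range b, ∑ k ∈ Finset.range i, (h 0 k + s 0 k) with hG
  set f : ℕ → ℕ → ℝ := fun a b =>
    F a + G b + ∑ i ∈ Finset.range a, ∑ j ∈ Finset.range b, s i j with hf
  have hS : ∀ i j, f i j + f (i + 1) (j + 1) - f (i + 1) j - f i (j + 1) = s i j := by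
    intro i j
    simp only [hf, Finset.sum_range_succ, Finset.sum_add_distrib]
    ring
  have hH : ∀ j i, i + j + 2 ≤ n →
      f i (j + 2) + f (i + 1) j - f i (j + 1) - f (i + 1) (j + 1) = h i j := by
    intro j i
    induction i with
    | zero =>
      intro _
      simp only [hf, hG, hF, Finset.sum_range_succ, Finset.sum_range_zero]
      ring
    | succ i ih =>
      intro hi
      linarith [ih (by omega), hS i (j + 1), hS (i + 1) j, hx i j (by omega)]
  have hV : ∀ i j, i + j + 2 ≤ n →
      f (i + 2) j + f i (j + 1) - f (i + 1) j - f (i + 1) (j + 1) = v i j := by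
    intro i j
    induction j with
    | zero =>
      intro _
      simp only [hf, hG, hF, Finset.sum_range_succ, Finset.sum_range_zero]
      ring
    | succ j ih =>
      intro hj
      linarith [ih (by omega), hS i (j + 1), hS (i + 1) j, hy i j (by omega)]
  exact ⟨f, fun i j hij => ⟨hS i j, hH j i hij, hV i j hij⟩⟩

/-- Either there are balanced weights on the interior edges of the grid that vanish exactly on the
edges in `DS`, `DH`, `DV`, or there is a nontrivial vector field `(x, y)` on the grid, zero at the
boundary, that does not contract any other edge. -/
theorem exists_balanced_weights (n : ℕ) (DS DH DV : ℕ → ℕ → Prop)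
    (hfield : ∀ x y : ℕ → ℕ → ℝ,
      (∀ a b, ¬ (1 ≤ a ∧ 1 ≤ b ∧ a + b + 1 ≤ n) → x a b = 0 ∧ y a b = 0) →
      (∀ i j, i + j + 2 ≤ n →
        (¬ DS i j → y (i + 1) j - x (i + 1) j ≤ y i (j + 1) - x i (j + 1)) ∧
        (¬ DH i j → x i (j + 1) ≤ x (i + 1) (j + 1)) ∧
        (¬ DV i j → y (i + 1) j ≤ y (i + 1) (j + 1))) →
      ∀ a b, x a b = 0 ∧ y a b = 0) :
    ∃ s h v : ℕ → ℕ → ℝ,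
      (∀ i j, i + j + 2 ≤ n → (0 ≤ s i j ∧ (s i j = 0 ↔ DS i j)) ∧
        (0 ≤ h i j ∧ (h i j = 0 ↔ DH i j)) ∧ (0 ≤ v i j ∧ (v i j = 0 ↔ DV i j))) ∧
      (∀ a b, a + b + 3 ≤ n → h (a + 1) b - h a b - s a (b + 1) + s (a + 1) b = 0) ∧
      (∀ a b, a + b + 3 ≤ n → v a (b + 1) - v a b + s a (b + 1) - s (a + 1) b = 0) := by
  classical
  let D : Finset (ℕ × ℕ) := {p ∈ Finset.range n ×ˢ Finset.range n | p.1 + p.2 + 2 ≤ n}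
  have hD : ∀ i j, (i, j) ∈ D ↔ i + j + 2 ≤ n := by
    intro i j
    simp only [D, Finset.mem_filter, Finset.mem_product, Finset.mem_range]
    omega
  -- The edges that must get positive weight. Every interior edge is a side of exactly one down
  -- triangle, and `Fin 3` numbers the three sides.
  let E : Finset ((ℕ × ℕ) × Fin 3) :=
    {e ∈ D ×ˢ Finset.univ | ¬ ![DS, DH, DV] e.2 e.1.1 e.1.2}
  have hE : ∀ i j k, ((i, j), k) ∈ E ↔ i + j + 2 ≤ n ∧ ¬ ![DS, DH, DV] k i j := by
    intro i j k
    simp [E, hD]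
  let I : ℕ → ℕ → Prop := fun a b => 1 ≤ a ∧ 1 ≤ b ∧ a + b + 1 ≤ n
  let cut : (ℕ → ℕ → ℝ) →ₗ[ℝ] (ℕ → ℕ → ℝ) :=
    { toFun := fun x a b => if I a b then x a b else 0
      map_add' := by intro x y; ext a b; by_cases h : I a b <;> simp [h]
      map_smul' := by intro r x; ext a b; by_cases h : I a b <;> simp [h] }
  -- The strains of a field along the edges, where `X.1` and `X.2` are its inner products with the
  -- directions `(1, 0)` and `(0, 1)`. Balance of weights means orthogonality to all strains.
  let str : ((ℕ → ℕ → ℝ) × (ℕ → ℕ → ℝ)) →ₗ[ℝ] ((ℕ × ℕ) × Fin 3 → ℝ) :=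
    { toFun := fun X e => ![(X.2 e.1.1 (e.1.2 + 1) - X.1 e.1.1 (e.1.2 + 1))
          - (X.2 (e.1.1 + 1) e.1.2 - X.1 (e.1.1 + 1) e.1.2),
        X.1 (e.1.1 + 1) (e.1.2 + 1) - X.1 e.1.1 (e.1.2 + 1),
        X.2 (e.1.1 + 1) (e.1.2 + 1) - X.2 (e.1.1 + 1) e.1.2] e.2
      map_add' := by
        rintro X Y; ext ⟨⟨i, j⟩, k⟩; fin_cases k <;> simp <;> ring
      map_smul' := by
        rintro r X; ext ⟨⟨i, j⟩, k⟩; fin_cases k <;> simp <;> ring }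
  let B := str ∘ₗ (cut.prodMap cut)
  obtain ⟨w, hw1, hw2, hw3⟩ := exists_pos_orthogonal E (LinearMap.range B) (by
    rintro _ ⟨X, rfl⟩ hc
    have hz := hfield (cut X.1) (cut X.2) (by
        intro a b hab
        have : ¬ I a b := hab
        simp [cut, this]) (by
        intro i j hij
        refine ⟨fun h => ?_, fun h => ?_, fun h => ?_⟩
        · have := hc ((i, j), 0) ((hE _ _ _).2 ⟨hij, h⟩)
          simp [B, str] at this
          linarith
        · have := hc ((i, j), 1) ((hE _ _ _).2 ⟨hij, h⟩)
          simp [B, str] at this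
          linarith
        · have := hc ((i, j), 2) ((hE _ _ _).2 ⟨hij, h⟩)
          simp [B, str] at this
          linarith)
    rintro ⟨⟨i, j⟩, k⟩ -
    fin_cases k <;> simp [B, str, hz])
  have hsum : ∀ X, ∑ p ∈ D, ∑ k : Fin 3, w (p, k) * B X (p, k) = 0 := by
    intro X
    rw [← hw3 _ ⟨X, rfl⟩, ← Finset.sum_product']
    symm
    refine Finset.sum_subset (Finset.filter_subset _ _) fun e _ he => ?_
    simp [hw2 e he]
  have hval : ∀ k i j, i + j + 2 ≤ n →
      0 ≤ w ((i, j), k) ∧ (w ((i, j), k) = 0 ↔ ![DS, DH, DV] k i j) := by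
    intro k i j hij
    by_cases h : ![DS, DH, DV] k i j
    · have := hw2 ((i, j), k) (by rw [hE]; tauto)
      exact ⟨this.ge, by tauto⟩
    · have := hw1 ((i, j), k) ((hE _ _ _).2 ⟨hij, h⟩)
      exact ⟨this.le, fun h0 => absurd h0 this.ne', fun h' => absurd h' h⟩
  have hdelta : ∀ (φ : ℕ × ℕ → ℝ) (a b : ℕ), a + b + 2 ≤ n →
      ∑ p ∈ D, (if p.1 = a ∧ p.2 = b then φ p else 0) = φ (a, b) := by
    intro φ a b hab
    rw [Finset.sum_eq_single (a, b)]
    · simp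
    · rintro ⟨i, j⟩ _ hne
      rw [if_neg]
      rintro ⟨rfl, rfl⟩
      exact hne rfl
    · intro hn
      exact absurd ((hD a b).2 hab) hn
  refine ⟨fun i j => w ((i, j), 0), fun i j => w ((i, j), 1), fun i j => w ((i, j), 2),
    fun i j hij => ⟨hval 0 i j hij, hval 1 i j hij, hval 2 i j hij⟩, ?_, ?_⟩
  · intro a b hab
    -- The test field is concentrated at the interior vertex `(a + 1, b + 1)`: its first component
    -- gives one balance equation there, and the second gives the other below.
    have := hsum (fun p q => if p = a + 1 ∧ q = b + 1 then 1 else 0, 0)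
    have hI : ∀ p q : ℕ, (if I p q then (if p = a + 1 ∧ q = b + 1 then (1 : ℝ) else 0) else 0)
        = if p = a + 1 ∧ q = b + 1 then 1 else 0 := by
      intro p q
      by_cases h : p = a + 1 ∧ q = b + 1
      · rw [if_pos]
        obtain ⟨rfl, rfl⟩ := h
        exact ⟨by omega, by omega, by omega⟩
      · simp [h]
    have hterm : ∀ p : ℕ × ℕ, ∑ k : Fin 3, w (p, k) *
        B (fun p q => if p = a + 1 ∧ q = b + 1 then 1 else 0, 0) (p, k) =
        (if p.1 = a ∧ p.2 = b + 1 then w (p, 0) else 0)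
        - (if p.1 = a + 1 ∧ p.2 = b then w (p, 0) else 0)
        + (if p.1 = a ∧ p.2 = b then w (p, 1) else 0)
        - (if p.1 = a + 1 ∧ p.2 = b then w (p, 1) else 0) := by
      intro p
      simp [Fin.sum_univ_three, B, str, cut, hI]
      simp only [mul_add, mul_sub, mul_neg, mul_ite, mul_one, mul_zero]
      ring
    rw [Finset.sum_congr rfl fun p _ => hterm p] at this
    simp only [Finset.sum_add_distrib, Finset.sum_sub_distrib] at this
    rw [hdelta (fun p => w (p, 0)) _ _ (by omega), hdelta (fun p => w (p, 0)) _ _ (by omega),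
      hdelta (fun p => w (p, 1)) _ _ (by omega), hdelta (fun p => w (p, 1)) _ _ (by omega)] at this
    linarith
  · intro a b hab
    have := hsum (0, fun p q => if p = a + 1 ∧ q = b + 1 then 1 else 0)
    have hI : ∀ p q : ℕ, (if I p q then (if p = a + 1 ∧ q = b + 1 then (1 : ℝ) else 0) else 0)
        = if p = a + 1 ∧ q = b + 1 then 1 else 0 := by
      intro p q
      by_cases h : p = a + 1 ∧ q = b + 1
      · rw [if_pos]
        obtain ⟨rfl, rfl⟩ := h
        exact ⟨by omega, by omega, by omega⟩
      · simp [h]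
    have hterm : ∀ p : ℕ × ℕ, ∑ k : Fin 3, w (p, k) *
        B (0, fun p q => if p = a + 1 ∧ q = b + 1 then 1 else 0) (p, k) =
        (if p.1 = a + 1 ∧ p.2 = b then w (p, 0) else 0)
        - (if p.1 = a ∧ p.2 = b + 1 then w (p, 0) else 0)
        + (if p.1 = a ∧ p.2 = b then w (p, 2) else 0)
        - (if p.1 = a ∧ p.2 = b + 1 then w (p, 2) else 0) := by
      intro p
      simp [Fin.sum_univ_three, B, str, cut, hI]
      simp only [mul_sub, mul_ite, mul_one, mul_zero]
      ring
    rw [Finset.sum_congr rfl fun p _ => hterm p] at this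
    simp only [Finset.sum_add_distrib, Finset.sum_sub_distrib] at this
    rw [hdelta (fun p => w (p, 0)) _ _ (by omega), hdelta (fun p => w (p, 0)) _ _ (by omega),
      hdelta (fun p => w (p, 2)) _ _ (by omega), hdelta (fun p => w (p, 2)) _ _ (by omega)] at this
    linarith

/-! ### From a vector field to closed walks -/

theorem exists_periodicPt {X : Type*} {f : X → X} {A : Set X} (hA : A.Finite)
    (hf : Set.MapsTo f A A) {x : X} (hx : x ∈ A) : ∃ y ∈ A, y ∈ Function.periodicPts f := by
  have hmem : ∀ k, f^[k] x ∈ A := fun k => hf.iterate k hx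
  have : ¬ Function.Injective fun k : ℕ => (⟨f^[k] x, hmem k⟩ : A) := by
    have := hA.to_subtype
    exact not_injective_infinite_finite _
  simp only [Function.Injective, not_forall] at this
  obtain ⟨i, j, hij, hne⟩ := this
  simp only [Subtype.mk.injEq] at hij
  wlog hlt : i < j generalizing i j
  · exact this j i (Ne.symm hne) hij.symm (by omega)
  refine ⟨f^[i] x, hmem i, Function.mk_mem_periodicPts (n := j - i) (by omega) ?_⟩
  rw [Function.IsPeriodicPt, Function.IsFixedPt, ← Function.iterate_add_apply,
    show j - i + i = j by omega, hij]

/-- The six directions of the edges of the triangular lattice, in lattice coordinates. -/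
def directions : Finset (ℤ × ℤ) := {(1, 0), (0, 1), (-1, 1), (-1, 0), (0, -1), (1, -1)}

/-- Rotation of lattice vectors by 60 degrees. -/
def rotate60 (u : ℤ × ℤ) : ℤ × ℤ := (-u.2, u.1 + u.2)

/-- The pairs of directions of two consecutive edges of a walk along two sides of an up triangle. -/
def sharpTurns : Finset ((ℤ × ℤ) × (ℤ × ℤ)) :=
  {((1, 0), (-1, 1)), ((-1, 1), (0, -1)), ((0, -1), (1, 0)),
    ((-1, 0), (0, 1)), ((1, -1), (-1, 0)), ((0, 1), (1, -1))}

/-- The numbers `x`, `y` are the inner products of a nonzero vector with the two lattice directions.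
Each direction has a single sharp predecessor, at an angle of 120 degrees, on alternating sides as
the direction rotates. There are always two neighbouring directions of positive product whose sharp
predecessors have nonpositive product, and `D` contains at most one of the two. -/
theorem exists_direction {x y : ℝ} (hxy : x ≠ 0 ∨ y ≠ 0) (D : ℤ × ℤ → Prop)
    (hD : ∀ u ∈ directions, ¬ (D u ∧ D (rotate60 u))) :
    ∃ o ∈ directions, 0 < o.1 * x + o.2 * y ∧ ¬ D o ∧
      ∀ i ∈ directions, 0 < i.1 * x + i.2 * y → (i, o) ∉ sharpTurns := by
  have h0 := hD (1, 0) (by decide)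
  have h1 := hD (0, 1) (by decide)
  have h2 := hD (-1, 1) (by decide)
  have h3 := hD (-1, 0) (by decide)
  have h4 := hD (0, -1) (by decide)
  have h5 := hD (1, -1) (by decide)
  simp only [rotate60] at h0 h1 h2 h3 h4 h5
  norm_num at h0 h1 h2 h3 h4 h5
  -- Each of `k0` to `k5` treats one direction: its first two hypotheses say that its own product is
  -- positive and that of its sharp predecessor is not.
  have k0 : 0 < x → 0 ≤ y → ¬ D (1, 0) → ∃ o ∈ directions, 0 < o.1 * x + o.2 * y ∧ ¬ D o ∧
      ∀ i ∈ directions, 0 < i.1 * x + i.2 * y → (i, o) ∉ sharpTurns := by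
    intro hx hy h
    refine ⟨_, by decide, by push_cast; linarith, h, ?_⟩
    simp only [directions, Finset.mem_insert, Finset.mem_singleton]
    rintro i (rfl | rfl | rfl | rfl | rfl | rfl) hi <;> first | decide | (push_cast at hi; linarith)
  have k1 : 0 < y → 0 ≤ x → ¬ D (0, 1) → ∃ o ∈ directions, 0 < o.1 * x + o.2 * y ∧ ¬ D o ∧
      ∀ i ∈ directions, 0 < i.1 * x + i.2 * y → (i, o) ∉ sharpTurns := by
    intro hx hy h
    refine ⟨_, by decide, by push_cast; linarith, h, ?_⟩
    simp only [directions, Finset.mem_insert, Finset.mem_singleton]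
    rintro i (rfl | rfl | rfl | rfl | rfl | rfl) hi <;> first | decide | (push_cast at hi; linarith)
  have k2 : x < y → x ≤ 0 → ¬ D (-1, 1) → ∃ o ∈ directions, 0 < o.1 * x + o.2 * y ∧ ¬ D o ∧
      ∀ i ∈ directions, 0 < i.1 * x + i.2 * y → (i, o) ∉ sharpTurns := by
    intro hx hy h
    refine ⟨_, by decide, by push_cast; linarith, h, ?_⟩
    simp only [directions, Finset.mem_insert, Finset.mem_singleton]
    rintro i (rfl | rfl | rfl | rfl | rfl | rfl) hi <;> first | decide | (push_cast at hi; linarith)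
  have k3 : x < 0 → x ≤ y → ¬ D (-1, 0) → ∃ o ∈ directions, 0 < o.1 * x + o.2 * y ∧ ¬ D o ∧
      ∀ i ∈ directions, 0 < i.1 * x + i.2 * y → (i, o) ∉ sharpTurns := by
    intro hx hy h
    refine ⟨_, by decide, by push_cast; linarith, h, ?_⟩
    simp only [directions, Finset.mem_insert, Finset.mem_singleton]
    rintro i (rfl | rfl | rfl | rfl | rfl | rfl) hi <;> first | decide | (push_cast at hi; linarith)
  have k4 : y < 0 → y ≤ x → ¬ D (0, -1) → ∃ o ∈ directions, 0 < o.1 * x + o.2 * y ∧ ¬ D o ∧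
      ∀ i ∈ directions, 0 < i.1 * x + i.2 * y → (i, o) ∉ sharpTurns := by
    intro hx hy h
    refine ⟨_, by decide, by push_cast; linarith, h, ?_⟩
    simp only [directions, Finset.mem_insert, Finset.mem_singleton]
    rintro i (rfl | rfl | rfl | rfl | rfl | rfl) hi <;> first | decide | (push_cast at hi; linarith)
  have k5 : y < x → y ≤ 0 → ¬ D (1, -1) → ∃ o ∈ directions, 0 < o.1 * x + o.2 * y ∧ ¬ D o ∧
      ∀ i ∈ directions, 0 < i.1 * x + i.2 * y → (i, o) ∉ sharpTurns := by
    intro hx hy h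
    refine ⟨_, by decide, by push_cast; linarith, h, ?_⟩
    simp only [directions, Finset.mem_insert, Finset.mem_singleton]
    rintro i (rfl | rfl | rfl | rfl | rfl | rfl) hi <;> first | decide | (push_cast at hi; linarith)
  rcases lt_trichotomy x 0 with hx | hx | hx
  · rcases le_or_gt 0 y with hy | hy
    · by_cases h : D (-1, 1)
      · exact k3 hx (by linarith) (h2 h)
      · exact k2 (by linarith) hx.le h
    · rcases lt_trichotomy x y with hlt | heq | hlt
      · by_cases h : D (-1, 1)
        · exact k3 hx hlt.le (h2 h)
        · exact k2 hlt hx.le h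
      · by_cases h : D (-1, 0)
        · exact k4 hy heq.ge (h3 h)
        · exact k3 hx heq.le h
      · by_cases h : D (0, -1)
        · exact k5 hlt hy.le (h4 h)
        · exact k4 hy hlt.le h
  · rcases lt_trichotomy y 0 with hy | hy | hy
    · by_cases h : D (0, -1)
      · exact k5 (by linarith) hy.le (h4 h)
      · exact k4 hy (by linarith) h
    · rcases hxy with h | h <;> contradiction
    · by_cases h : D (0, 1)
      · exact k2 (by linarith) hx.le (h1 h)
      · exact k1 hy hx.ge h
  · rcases lt_trichotomy y 0 with hy | hy | hy
    · by_cases h : D (0, -1)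
      · exact k5 (by linarith) hy.le (h4 h)
      · exact k4 hy (by linarith) h
    · by_cases h : D (1, -1)
      · exact k0 hx hy.ge (h5 h)
      · exact k5 (by linarith) hy.le h
    · by_cases h : D (1, 0)
      · exact k1 hy hx.le (h0 h)
      · exact k0 hx hy.le h

/-- A nonzero vector field on the grid with finite support that does not contract any edge outside
`D` yields disjoint closed walks, along edges outside `D`, without sharp turns: `Z` is the set of
their vertices and `o p` is the direction in which the walk through `p` leaves `p`. -/
theorem exists_closed_walks {x y : ℤ × ℤ → ℝ} (D : ℤ × ℤ → ℤ × ℤ → Prop)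
    (hfin : {p | x p ≠ 0 ∨ y p ≠ 0}.Finite) (hne : {p | x p ≠ 0 ∨ y p ≠ 0}.Nonempty)
    (hD : ∀ p, (x p ≠ 0 ∨ y p ≠ 0) → ∀ u ∈ directions, ¬ (D p u ∧ D p (rotate60 u)))
    (hmono : ∀ p, (x p ≠ 0 ∨ y p ≠ 0) → ∀ u ∈ directions, ¬ D p u →
      u.1 * x p + u.2 * y p ≤ u.1 * x (p + u) + u.2 * y (p + u)) :
    ∃ (Z : Set (ℤ × ℤ)) (o : ℤ × ℤ → ℤ × ℤ), Z.Nonempty ∧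
      (∀ p ∈ Z, (x p ≠ 0 ∨ y p ≠ 0) ∧ o p ∈ directions ∧ ¬ D p (o p) ∧ p + o p ∈ Z ∧
        (o p, o (p + o p)) ∉ sharpTurns ∧ o (p + o p) ≠ -o p) ∧
      (∀ p ∈ Z, ∀ q ∈ Z, p + o p = q + o q → p = q) ∧ ∀ q ∈ Z, ∃ p ∈ Z, p + o p = q := by
  classical
  choose! o ho1 ho2 ho3 ho4 using
    fun p (hp : x p ≠ 0 ∨ y p ≠ 0) => exists_direction hp (D p) (hD p hp)
  set N : Set (ℤ × ℤ) := {p | x p ≠ 0 ∨ y p ≠ 0} with hN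
  set next : ℤ × ℤ → ℤ × ℤ := fun p => if p ∈ N then p + o p else p with hnext
  have hnextN : ∀ p ∈ N, next p = p + o p := fun p hp => by simp [hnext, hp]
  -- As the edge is not contracted, the product stays positive at its far end. There the field is
  -- again nonzero, and `ho4` excludes a sharp turn.
  have hpos : ∀ p ∈ N, 0 < (o p).1 * x (p + o p) + (o p).2 * y (p + o p) := fun p hp =>
    (ho2 p hp).trans_le (hmono p hp _ (ho1 p hp) (ho3 p hp))
  have hmapsN : ∀ p ∈ N, p + o p ∈ N := by
    intro p hp
    by_contra h
    have h' : x (p + o p) = 0 ∧ y (p + o p) = 0 := by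
      simpa [hN, not_or] using h
    have := hpos p hp
    simp [h'.1, h'.2] at this
  have hmaps : Set.MapsTo next N N := fun p hp => by
    rw [hnextN p hp]
    exact hmapsN p hp
  -- Restricting to periodic points makes `next` a bijection, so the walks are closed and disjoint.
  have hbij := Function.bijOn_periodicPts next
  obtain ⟨p₀, hp₀⟩ := hne
  obtain ⟨y₀, hy₀, hy₀'⟩ := exists_periodicPt hfin hmaps hp₀
  refine ⟨N ∩ Function.periodicPts next, o, ⟨y₀, hy₀, hy₀'⟩, ?_, ?_, ?_⟩
  · rintro p ⟨hp, hp'⟩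
    refine ⟨hp, ho1 p hp, ho3 p hp, ⟨hmapsN p hp, ?_⟩,
      ho4 _ (hmapsN p hp) _ (ho1 p hp) (hpos p hp), fun h => ?_⟩
    · rw [← hnextN p hp]
      exact hbij.mapsTo hp'
    · have h1 := hpos p hp
      have h2 := ho2 _ (hmapsN p hp)
      rw [h, Prod.fst_neg, Prod.snd_neg] at h2
      push_cast at h2
      linarith
  · rintro p ⟨hp, hp'⟩ q ⟨hq, hq'⟩ h
    rw [← hnextN p hp, ← hnextN q hq] at h
    exact hbij.injOn hp' hq' h
  · rintro q ⟨hq, hq'⟩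
    obtain ⟨p, hp', hpq⟩ := hbij.surjOn hq'
    have hp : p ∈ N := by
      by_contra hp
      rw [hnext] at hpq
      simp only [hp, if_false] at hpq
      exact hp (hpq ▸ hq)
    exact ⟨p, ⟨hp, hp'⟩, by rw [← hnextN p hp, hpq]⟩

/-! ### Winding numbers -/

/-- The winding numbers of a family of disjoint closed walks in the interior of the triangular grid
around the unit triangles `up a b` and `down a b`. -/
theorem exists_winding {n : ℕ} {Z : Set (ℤ × ℤ)} {o : ℤ × ℤ → ℤ × ℤ} (hne : Z.Nonempty)
    (hint : ∀ p ∈ Z, 1 ≤ p.1 ∧ 1 ≤ p.2 ∧ p.1 + p.2 + 1 ≤ n)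
    (hdir : ∀ p ∈ Z, o p ∈ directions) (hnext : ∀ p ∈ Z, p + o p ∈ Z)
    (hsharp : ∀ p ∈ Z, (o p, o (p + o p)) ∉ sharpTurns) (hback : ∀ p ∈ Z, o (p + o p) ≠ -o p)
    (hinj : ∀ p ∈ Z, ∀ q ∈ Z, p + o p = q + o q → p = q)
    (hsurj : ∀ q ∈ Z, ∃ p ∈ Z, p + o p = q) :
    ∃ U D : ℕ → ℕ → ℤ,
      (∀ a b : ℕ, (¬ (((a : ℤ) + 1, (b : ℤ)) ∈ Z ∧ o ((a : ℤ) + 1, (b : ℤ)) = (-1, 1)) ∧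
        ¬ (((a : ℤ), (b : ℤ) + 1) ∈ Z ∧ o ((a : ℤ), (b : ℤ) + 1) = (1, -1))) → U a b = D a b) ∧
      (∀ a b : ℕ, (¬ (((a : ℤ), (b : ℤ) + 1) ∈ Z ∧ o ((a : ℤ), (b : ℤ) + 1) = (1, 0)) ∧
        ¬ (((a : ℤ) + 1, (b : ℤ) + 1) ∈ Z ∧ o ((a : ℤ) + 1, (b : ℤ) + 1) = (-1, 0))) →
        U a (b + 1) = D a b) ∧
      (∀ a b : ℕ, (¬ (((a : ℤ) + 1, (b : ℤ)) ∈ Z ∧ o ((a : ℤ) + 1, (b : ℤ)) = (0, 1)) ∧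
        ¬ (((a : ℤ) + 1, (b : ℤ) + 1) ∈ Z ∧ o ((a : ℤ) + 1, (b : ℤ) + 1) = (0, -1))) →
        U (a + 1) b = D a b) ∧
      (∀ a, U a 0 = 0) ∧ (∀ b, U 0 b = 0) ∧
      (∀ a b, n ≤ a + b + 1 → U a b = 0 ∧ D a b = 0) ∧
      (∀ a b, U a b = D a b ∨ b = 0 ∨ U a b = D a (b - 1)) ∧
      (∀ a b, U a b = D a b ∨ a = 0 ∨ U a b = D (a - 1) b) ∧
      (∀ a b, (b = 0 ∨ U a b = D a (b - 1)) ∨ a = 0 ∨ U a b = D (a - 1) b) ∧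
      ∃ a b, U a b ≠ 0 ∨ D a b ≠ 0 := by
  classical
  -- `fl p u` records whether a walk passes from `p` to `p + u`. The `zH`, `zV`, `zS` below are the
  -- net flows along the three sides of `up a b`.
  set fl : ℤ × ℤ → ℤ × ℤ → ℤ := fun p u => if p ∈ Z ∧ o p = u then 1 else 0 with hfl
  have hfl0 : ∀ p u, ¬ (p ∈ Z ∧ o p = u) → fl p u = 0 := fun p u h => if_neg h
  have hfl1 : ∀ p u, p ∈ Z ∧ o p = u → fl p u = 1 := fun p u h => if_pos h
  have hout : ∀ p, fl p (1, 0) + fl p (0, 1) + fl p (-1, 1) + fl p (-1, 0) + fl p (0, -1)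
      + fl p (1, -1) = if p ∈ Z then 1 else 0 := by
    intro p
    by_cases hp : p ∈ Z
    · have := hdir p hp
      simp only [directions, Finset.mem_insert, Finset.mem_singleton] at this
      rcases this with h | h | h | h | h | h <;> simp [hfl, hp, h]
    · simp [hfl, hp]
  have hin : ∀ p, fl (p - (1, 0)) (1, 0) + fl (p - (0, 1)) (0, 1) + fl (p - (-1, 1)) (-1, 1)
      + fl (p - (-1, 0)) (-1, 0) + fl (p - (0, -1)) (0, -1) + fl (p - (1, -1)) (1, -1)
      = if p ∈ Z then 1 else 0 := by
    intro p
    by_cases hp : p ∈ Z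
    · obtain ⟨q, hq, rfl⟩ := hsurj p hp
      have key : ∀ u, fl (q + o q - u) u = if o q = u then 1 else 0 := by
        intro u
        by_cases h : o q = u
        · subst h
          simp [hfl, hq]
        · rw [if_neg h, hfl0]
          rintro ⟨h1, h2⟩
          have := hinj _ h1 q hq (by rw [h2]; abel)
          rw [this] at h2
          exact h h2
      simp only [key, if_pos hp]
      have := hdir q hq
      simp only [directions, Finset.mem_insert, Finset.mem_singleton] at this
      rcases this with h | h | h | h | h | h <;> simp [h]
    · have key : ∀ u, fl (p - u) u = 0 := by
        intro u
        apply hfl0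
        rintro ⟨h1, h2⟩
        have := hnext _ h1
        rw [h2, sub_add_cancel] at this
        exact hp this
      simp [key, hp]
  set zH : ℤ → ℤ → ℤ := fun a b => fl (a, b) (1, 0) - fl (a + 1, b) (-1, 0) with hzH
  set zV : ℤ → ℤ → ℤ := fun a b => fl (a, b) (0, 1) - fl (a, b + 1) (0, -1) with hzV
  set zS : ℤ → ℤ → ℤ := fun a b => fl (a + 1, b) (-1, 1) - fl (a, b + 1) (1, -1) with hzS
  have hcons : ∀ a b : ℤ, zH a b + zV a b + zS (a - 1) b
      = zH (a - 1) b + zV a (b - 1) + zS a (b - 1) := by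
    intro a b
    have h := (hout (a, b)).trans (hin (a, b)).symm
    simp only [Prod.mk_sub_mk, sub_zero, sub_neg_eq_add] at h
    simp only [hzH, hzV, hzS, sub_add_cancel]
    linarith
  have hends : ∀ p u, fl p u ≠ 0 → (1 ≤ p.1 ∧ 1 ≤ p.2 ∧ p.1 + p.2 + 1 ≤ n) ∧
      1 ≤ p.1 + u.1 ∧ 1 ≤ p.2 + u.2 ∧ p.1 + u.1 + (p.2 + u.2) + 1 ≤ n := by
    intro p u h
    have h' : p ∈ Z ∧ o p = u := by
      by_contra h'
      exact h (hfl0 p u h')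
    obtain ⟨hp, rfl⟩ := h'
    exact ⟨hint p hp, hint _ (hnext p hp)⟩
  have hzH0 : ∀ a b : ℤ, ¬ (1 ≤ a ∧ 1 ≤ b ∧ a + b + 2 ≤ n) → zH a b = 0 := by
    intro a b h
    have h1 := mt (hends (a, b) (1, 0)) (by simp only; omega)
    have h2 := mt (hends (a + 1, b) (-1, 0)) (by simp only; omega)
    simp only [hzH]
    omega
  have hzV0 : ∀ a b : ℤ, ¬ (1 ≤ a ∧ 1 ≤ b ∧ a + b + 2 ≤ n) → zV a b = 0 := by
    intro a b h
    have h1 := mt (hends (a, b) (0, 1)) (by simp only; omega)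
    have h2 := mt (hends (a, b + 1) (0, -1)) (by simp only; omega)
    simp only [hzV]
    omega
  have hzS0 : ∀ a b : ℤ, ¬ (1 ≤ a ∧ 1 ≤ b ∧ a + b + 2 ≤ n) → zS a b = 0 := by
    intro a b h
    have h1 := mt (hends (a + 1, b) (-1, 1)) (by simp only; omega)
    have h2 := mt (hends (a, b + 1) (1, -1)) (by simp only; omega)
    simp only [hzS]
    omega
  -- The winding number is a signed count of crossings along row `b` from the left. Its jumps across
  -- edges of type `zV` and `zS` hold by definition; those across horizontal edges follow from
  -- conservation of flow, by induction along the row.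
  set U : ℕ → ℕ → ℤ := fun a b =>
    -∑ i ∈ Finset.range (a + 1), zV i b - ∑ i ∈ Finset.range a, zS i b with hU
  set D : ℕ → ℕ → ℤ := fun a b => U a b - zS a b with hD
  have jV : ∀ a b : ℕ, D a b - U (a + 1) b = zV (a + 1) b := by
    intro a b
    simp only [hD, hU, Finset.sum_range_succ]
    push_cast
    ring
  have jH : ∀ a b : ℕ, U a (b + 1) - D a b = zH a (b + 1) := by
    intro a b
    induction a with
    | zero =>
      have h := hcons 0 (b + 1)
      rw [hzS0 (0 - 1) _ (by omega), hzH0 (0 - 1) _ (by omega), add_sub_cancel_right] at h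
      simp only [hD, hU, Finset.sum_range_succ, Finset.sum_range_zero]
      push_cast
      linarith
    | succ a ih =>
      have h := hcons (a + 1) (b + 1)
      rw [add_sub_cancel_right, add_sub_cancel_right] at h
      have h1 := jV a b
      have h2 := jV a (b + 1)
      have h3 : D a (b + 1) = U a (b + 1) - zS a (b + 1) := by simp [hD]
      have h4 : D (a + 1) b = U (a + 1) b - zS (a + 1) b := by simp [hD]
      push_cast at *
      linarith
  have jS : ∀ a b : ℕ, U a b - D a b = zS a b := by
    intro a b
    simp only [hD]
    ring
  have hrow : ∀ a b : ℕ, ¬ (1 ≤ b ∧ b < n) → U a b = 0 := by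
    intro a b hb
    have h1 : ∀ i ∈ Finset.range (a + 1), zV (i : ℕ) b = 0 := fun i _ => hzV0 _ _ (by omega)
    have h2 : ∀ i ∈ Finset.range a, zS (i : ℕ) b = 0 := fun i _ => hzS0 _ _ (by omega)
    simp only [hU, Finset.sum_eq_zero h1, Finset.sum_eq_zero h2]
    rfl
  -- Beyond the hypotenuse no edge carries flow, so the number does not change on the way up to row
  -- `n`, where it is zero.
  have hUout : ∀ k a b : ℕ, n ≤ b + k → n ≤ a + b + 1 → U a b = 0 := by
    intro k
    induction k with
    | zero =>
      intro a b hb _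
      exact hrow a b (by omega)
    | succ k ih =>
      intro a b hb hab
      have h1 := ih a (b + 1) (by omega) (by omega)
      have h2 := jH a b
      have h3 := jS a b
      rw [hzH0 _ _ (by omega)] at h2
      rw [hzS0 _ _ (by omega)] at h3
      omega
  have nH : ∀ a b : ℤ, ¬ (((a, b) ∈ Z ∧ o (a, b) = (1, 0)) ∨
      ((a + 1, b) ∈ Z ∧ o (a + 1, b) = (-1, 0))) → zH a b = 0 := by
    intro a b h
    rw [not_or] at h
    simp only [hzH, hfl0 _ _ h.1, hfl0 _ _ h.2, sub_zero]
  have nV : ∀ a b : ℤ, ¬ (((a, b) ∈ Z ∧ o (a, b) = (0, 1)) ∨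
      ((a, b + 1) ∈ Z ∧ o (a, b + 1) = (0, -1))) → zV a b = 0 := by
    intro a b h
    rw [not_or] at h
    simp only [hzV, hfl0 _ _ h.1, hfl0 _ _ h.2, sub_zero]
  have nS : ∀ a b : ℤ, ¬ (((a + 1, b) ∈ Z ∧ o (a + 1, b) = (-1, 1)) ∨
      ((a, b + 1) ∈ Z ∧ o (a, b + 1) = (1, -1))) → zS a b = 0 := by
    intro a b h
    rw [not_or] at h
    simp only [hzS, hfl0 _ _ h.1, hfl0 _ _ h.2, sub_zero]
  have turn : ∀ p q : ℤ × ℤ, ∀ u v, p ∈ Z ∧ o p = u → p + u = q → o q = v →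
      (u, v) ∉ sharpTurns := by
    rintro p q u v ⟨hp, rfl⟩ rfl rfl
    exact hsharp p hp
  have merge : ∀ p q : ℤ × ℤ, ∀ u v, p ∈ Z ∧ o p = u → q ∈ Z ∧ o q = v → p + u = q + v →
      p = q := by
    rintro p q u v ⟨hp, rfl⟩ ⟨hq, rfl⟩ h
    exact hinj p hp q hq h
  -- Two sides of an up triangle meet in a vertex. If both carried flow, the walks would turn
  -- sharply there, or arrive twice against `hinj`, or leave in two directions.
  have xHV : ∀ a b : ℤ, zH a b = 0 ∨ zV a b = 0 := by
    intro a b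
    by_contra! hh
    rcases not_not.1 (mt (nH a b) hh.1) with h1 | h1 <;>
      rcases not_not.1 (mt (nV a b) hh.2) with h2 | h2
    · have := h1.2.symm.trans h2.2
      simp at this
    · exact turn _ _ _ _ h2 (by simp) h1.2 (by decide)
    · exact turn _ _ _ _ h1 (by simp) h2.2 (by decide)
    · have := merge _ _ _ _ h1 h2 (by simp)
      simp at this
  have xHS : ∀ a b : ℤ, zH a b = 0 ∨ zS a b = 0 := by
    intro a b
    by_contra! hh
    rcases not_not.1 (mt (nH a b) hh.1) with h1 | h1 <;>
      rcases not_not.1 (mt (nS a b) hh.2) with h2 | h2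
    · exact turn _ _ _ _ h1 (by simp) h2.2 (by decide)
    · have := merge _ _ _ _ h1 h2 (by simp)
      simp at this
    · have := h1.2.symm.trans h2.2
      simp at this
    · exact turn _ _ _ _ h2 (by simp) h1.2 (by decide)
  have xVS : ∀ a b : ℤ, zV a b = 0 ∨ zS a b = 0 := by
    intro a b
    by_contra! hh
    rcases not_not.1 (mt (nV a b) hh.1) with h1 | h1 <;>
      rcases not_not.1 (mt (nS a b) hh.2) with h2 | h2
    · have := merge _ _ _ _ h1 h2 (by simp)
      simp at this
    · exact turn _ _ _ _ h1 (by simp) h2.2 (by decide)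
    · exact turn _ _ _ _ h2 (by simp) h1.2 (by decide)
    · have := h1.2.symm.trans h2.2
      simp at this
  have eqH : ∀ a b : ℕ, zH a b = 0 → b = 0 ∨ U a b = D a (b - 1) := by
    intro a b h
    rcases b with _ | b
    · exact Or.inl rfl
    · right
      have := jH a b
      push_cast at h
      simp only [Nat.add_sub_cancel]
      omega
  have eqV : ∀ a b : ℕ, zV a b = 0 → a = 0 ∨ U a b = D (a - 1) b := by
    intro a b h
    rcases a with _ | a
    · exact Or.inl rfl
    · right
      have := jV a b
      push_cast at h
      simp only [Nat.add_sub_cancel]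
      omega
  have eqS : ∀ a b : ℕ, zS a b = 0 → U a b = D a b := by
    intro a b h
    have := jS a b
    omega
  refine ⟨U, D, ?_, ?_, ?_, ?_, ?_, ?_, ?_, ?_, ?_, ?_⟩
  · intro a b h
    exact eqS a b (nS a b (not_or.2 h))
  · intro a b h
    have := jH a b
    rw [nH a (b + 1) (not_or.2 h)] at this
    omega
  · intro a b h
    have := jV a b
    rw [nV (a + 1) b (not_or.2 h)] at this
    omega
  · intro a
    exact hrow a 0 (by omega)
  · intro b
    simp [hU, hzV0 0 b (by omega)]
  · intro a b h
    have h1 := hUout n a b (by omega) h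
    have h2 := jS a b
    rw [hzS0 _ _ (by omega)] at h2
    exact ⟨h1, by omega⟩
  · intro a b
    rcases xHS a b with h | h
    · exact Or.inr (eqH a b h)
    · exact Or.inl (eqS a b h)
  · intro a b
    rcases xVS a b with h | h
    · exact Or.inr (eqV a b h)
    · exact Or.inl (eqS a b h)
  · intro a b
    rcases xHV a b with h | h
    · exact Or.inl (eqH a b h)
    · exact Or.inr (eqV a b h)
  -- Vanishing winding numbers force vanishing net flows. But the edge by which a walk leaves a
  -- point is never run backwards, so its net flow is nonzero.
  · by_contra! hall
    have hH : ∀ a b : ℤ, zH a b = 0 := by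
      intro a b
      by_contra h
      have hab := not_not.1 (mt (hzH0 a b) h)
      obtain ⟨a, rfl⟩ := Int.eq_ofNat_of_zero_le (show 0 ≤ a by omega)
      obtain ⟨b, rfl⟩ : ∃ k : ℕ, b = k + 1 := ⟨(b - 1).toNat, by omega⟩
      rw [← jH, (hall _ _).1, (hall _ _).2] at h
      exact h rfl
    have hV : ∀ a b : ℤ, zV a b = 0 := by
      intro a b
      by_contra h
      have hab := not_not.1 (mt (hzV0 a b) h)
      obtain ⟨b, rfl⟩ := Int.eq_ofNat_of_zero_le (show 0 ≤ b by omega)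
      obtain ⟨a, rfl⟩ : ∃ k : ℕ, a = k + 1 := ⟨(a - 1).toNat, by omega⟩
      rw [← jV, (hall _ _).1, (hall _ _).2] at h
      exact h rfl
    have hS : ∀ a b : ℤ, zS a b = 0 := by
      intro a b
      by_contra h
      have hab := not_not.1 (mt (hzS0 a b) h)
      obtain ⟨a, rfl⟩ := Int.eq_ofNat_of_zero_le (show 0 ≤ a by omega)
      obtain ⟨b, rfl⟩ := Int.eq_ofNat_of_zero_le (show 0 ≤ b by omega)
      rw [← jS, (hall _ _).1, (hall _ _).2] at h
      exact h rfl
    obtain ⟨⟨a, b⟩, hp⟩ := hne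
    have noback : ∀ u, o (a, b) = u → fl (a, b) u - fl ((a, b) + u) (-u) = 1 := by
      rintro u rfl
      rw [hfl1 _ _ ⟨hp, rfl⟩, hfl0 _ _ fun h => hback _ hp h.2, sub_zero]
    have := hdir _ hp
    simp only [directions, Finset.mem_insert, Finset.mem_singleton] at this
    rcases this with h | h | h | h | h | h
    · have h1 := noback _ h
      have h2 := hH a b
      simp [hzH] at h1 h2
      omega
    · have h1 := noback _ h
      have h2 := hV a b
      simp [hzV] at h1 h2
      omega
    · have h1 := noback _ h
      have h2 := hS (a - 1) b
      simp [hzS, ← sub_eq_add_neg] at h1 h2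
      omega
    · have h1 := noback _ h
      have h2 := hH (a - 1) b
      simp [hzH, ← sub_eq_add_neg] at h1 h2
      omega
    · have h1 := noback _ h
      have h2 := hV a (b - 1)
      simp [hzV, ← sub_eq_add_neg] at h1 h2
      omega
    · have h1 := noback _ h
      have h2 := hS a (b - 1)
      simp [hzS, ← sub_eq_add_neg] at h1 h2
      omega

/-! ### Subdivisions as matchings -/

theorem inside_up {n a b : ℕ} : (UnitTriangle.up a b).Inside 0 0 n ↔ a + b + 1 ≤ n := by
  simp [UnitTriangle.Inside, UnitTriangle.vertices]
  omega

theorem inside_down {n a b : ℕ} : (UnitTriangle.down a b).Inside 0 0 n ↔ a + b + 2 ≤ n := by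
  simp [UnitTriangle.Inside, UnitTriangle.vertices]
  omega

/-- `up u.1 u.2` shares an edge with `down p.1 p.2`. -/
def Adjacent (p u : ℕ × ℕ) : Prop :=
  u = (p.1, p.2) ∨ u = (p.1, p.2 + 1) ∨ u = (p.1 + 1, p.2)

theorem Adjacent.card_inter {p u : ℕ × ℕ} (h : Adjacent p u) :
    ((UnitTriangle.down p.1 p.2).vertices ∩ (UnitTriangle.up u.1 u.2).vertices).card = 2 := by
  obtain ⟨i, j⟩ := p
  rw [Finset.card_eq_two]
  rcases h with rfl | rfl | rfl
  · refine ⟨(i + 1, j), (i, j + 1), by simp, ?_⟩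
    ext ⟨x, y⟩
    simp only [UnitTriangle.vertices, Finset.mem_inter, Finset.mem_insert, Finset.mem_singleton,
      Prod.mk.injEq]
    omega
  · refine ⟨(i, j + 1), (i + 1, j + 1), by simp, ?_⟩
    ext ⟨x, y⟩
    simp only [UnitTriangle.vertices, Finset.mem_inter, Finset.mem_insert, Finset.mem_singleton,
      Prod.mk.injEq]
    omega
  · refine ⟨(i + 1, j), (i + 1, j + 1), by simp, ?_⟩
    ext ⟨x, y⟩
    simp only [UnitTriangle.vertices, Finset.mem_inter, Finset.mem_insert, Finset.mem_singleton,
      Prod.mk.injEq]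
    omega

/-- Distinct unit triangles of the same orientation have at most one common vertex, so an edge is
shared only by an up and a down triangle. -/
theorem exists_adjacent_of_card_inter {s t : UnitTriangle}
    (h : (s.vertices ∩ t.vertices).card = 2) :
    ∃ p u : ℕ × ℕ, Adjacent p u ∧
      ((s = .down p.1 p.2 ∧ t = .up u.1 u.2) ∨ (t = .down p.1 p.2 ∧ s = .up u.1 u.2)) := by
  obtain ⟨⟨x, y⟩, ⟨x', y'⟩, hne, hst⟩ := Finset.card_eq_two.1 h
  have h1 : (x, y) ∈ s.vertices ∩ t.vertices := by simp [hst]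
  have h2 : (x', y') ∈ s.vertices ∩ t.vertices := by simp [hst]
  have h3 : ∀ a b, (a, b) ∈ s.vertices → (a, b) ∈ t.vertices →
      (a = x ∧ b = y) ∨ (a = x' ∧ b = y') := by
    intro a b ha hb
    have : (a, b) ∈ s.vertices ∩ t.vertices := Finset.mem_inter.2 ⟨ha, hb⟩
    simpa [hst] using this
  have hne' : ¬ (x = x' ∧ y = y') := by
    rintro ⟨rfl, rfl⟩
    exact hne rfl
  rw [Finset.mem_inter] at h1 h2
  rcases s with ⟨a, b⟩ | ⟨a, b⟩ <;> rcases t with ⟨c, d⟩ | ⟨c, d⟩ <;>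
    simp only [UnitTriangle.vertices, Finset.mem_insert, Finset.mem_singleton, Prod.mk.injEq]
      at h1 h2 h3
  · exfalso
    by_cases hac : a = c ∧ b = d
    · obtain ⟨rfl, rfl⟩ := hac
      have k1 := h3 a b (by simp) (by simp)
      have k2 := h3 (a + 1) b (by simp) (by simp)
      have k3 := h3 a (b + 1) (by simp) (by simp)
      omega
    · clear h3
      obtain ⟨h1 | h1 | h1, h1' | h1' | h1'⟩ := h1 <;>
        obtain ⟨h2 | h2 | h2, h2' | h2' | h2'⟩ := h2 <;> omega
  · refine ⟨(c, d), (a, b), ?_, Or.inr ⟨rfl, rfl⟩⟩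
    simp only [Adjacent, Prod.mk.injEq]
    clear h3
    obtain ⟨h1 | h1 | h1, h1' | h1' | h1'⟩ := h1 <;>
      obtain ⟨h2 | h2 | h2, h2' | h2' | h2'⟩ := h2 <;> omega
  · refine ⟨(a, b), (c, d), ?_, Or.inl ⟨rfl, rfl⟩⟩
    simp only [Adjacent, Prod.mk.injEq]
    clear h3
    obtain ⟨h1 | h1 | h1, h1' | h1' | h1'⟩ := h1 <;>
      obtain ⟨h2 | h2 | h2, h2' | h2' | h2'⟩ := h2 <;> omega
  · exfalso
    by_cases hac : a = c ∧ b = d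
    · obtain ⟨rfl, rfl⟩ := hac
      have k1 := h3 (a + 1) (b + 1) (by simp) (by simp)
      have k2 := h3 (a + 1) b (by simp) (by simp)
      have k3 := h3 a (b + 1) (by simp) (by simp)
      omega
    · clear h3
      obtain ⟨h1 | h1 | h1, h1' | h1' | h1'⟩ := h1 <;>
        obtain ⟨h2 | h2 | h2, h2' | h2' | h2'⟩ := h2 <;> omega

/-- The rhombus formed by two unit triangles. -/
def rhombus (p u : ℕ × ℕ) : Set UnitTriangle := {.down p.1 p.2, .up u.1 u.2}

theorem rhombus_inj {p u p' u' : ℕ × ℕ} (h : rhombus p u = rhombus p' u') : p = p' ∧ u = u' := by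
  have h1 : UnitTriangle.down p.1 p.2 ∈ rhombus p' u' := h ▸ Set.mem_insert _ _
  have h2 : UnitTriangle.up u.1 u.2 ∈ rhombus p' u' :=
    h ▸ Set.mem_insert_of_mem _ (Set.mem_singleton _)
  simp [rhombus] at h1 h2
  exact ⟨Prod.ext h1.1 h1.2, Prod.ext h2.1 h2.2⟩

theorem isRhombus_iff {c : Set UnitTriangle} :
    IsRhombus c ↔ ∃ p u, Adjacent p u ∧ c = rhombus p u := by
  constructor
  · rintro ⟨s, t, h, rfl⟩
    obtain ⟨p, u, hpu, ⟨rfl, rfl⟩ | ⟨rfl, rfl⟩⟩ := exists_adjacent_of_card_inter h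
    · exact ⟨p, u, hpu, rfl⟩
    · exact ⟨p, u, hpu, Set.pair_comm _ _⟩
  · rintro ⟨p, u, hpu, rfl⟩
    exact ⟨_, _, hpu.card_inter, rfl⟩

theorem not_isUpTile_rhombus (p u : ℕ × ℕ) : ¬ IsUpTile (rhombus p u) := by
  rintro ⟨t, ht, h⟩
  have h1 : UnitTriangle.down p.1 p.2 ∈ ({t} : Set UnitTriangle) := h ▸ Set.mem_insert _ _
  rw [Set.mem_singleton_iff] at h1
  subst h1
  exact ht

/-- `m` matches the down triangles with the up triangles that are not in `S`. -/
structure IsMatching (n : ℕ) (S : Set UnitTriangle) (m : ℕ × ℕ → ℕ × ℕ) : Prop where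
  adjacent : ∀ p : ℕ × ℕ, p.1 + p.2 + 2 ≤ n → Adjacent p (m p)
  notMem : ∀ p : ℕ × ℕ, p.1 + p.2 + 2 ≤ n → UnitTriangle.up (m p).1 (m p).2 ∉ S
  inj : ∀ p q : ℕ × ℕ, p.1 + p.2 + 2 ≤ n → q.1 + q.2 + 2 ≤ n → m p = m q → p = q
  surj : ∀ u : ℕ × ℕ, u.1 + u.2 + 1 ≤ n → UnitTriangle.up u.1 u.2 ∉ S →
    ∃ p : ℕ × ℕ, p.1 + p.2 + 2 ≤ n ∧ m p = u

/-- The tiling with holes `S` whose rhombi are given by the matching `m`. -/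
def tiling (n : ℕ) (S : Set UnitTriangle) (m : ℕ × ℕ → ℕ × ℕ) : Set (Set UnitTriangle) :=
  {c | (∃ t ∈ S, c = {t}) ∨ ∃ p : ℕ × ℕ, p.1 + p.2 + 2 ≤ n ∧ c = rhombus p (m p)}

/-- Each rhombus contains exactly one down triangle, so the number of rhombi does not depend on the
matching. -/
theorem ncard_rhombi_tiling {n : ℕ} {S : Set UnitTriangle} (hS : ∀ t ∈ S, t.IsUp)
    {m : ℕ × ℕ → ℕ × ℕ} (hm : IsMatching n S m) :
    {c | c ∈ tiling n S m ∧ IsRhombus c}.ncard = {p : ℕ × ℕ | p.1 + p.2 + 2 ≤ n}.ncard := by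
  have : {c | c ∈ tiling n S m ∧ IsRhombus c}
      = (fun p => rhombus p (m p)) '' {p : ℕ × ℕ | p.1 + p.2 + 2 ≤ n} := by
    ext c
    constructor
    · rintro ⟨⟨t, ht, rfl⟩ | ⟨p, hp, rfl⟩, hr⟩
      · obtain ⟨p, u, -, h⟩ := isRhombus_iff.1 hr
        exact absurd ⟨t, hS t ht, h.symm⟩ (not_isUpTile_rhombus p u)
      · exact ⟨p, hp, rfl⟩
    · rintro ⟨p, hp, rfl⟩
      exact ⟨Or.inr ⟨p, hp, rfl⟩, isRhombus_iff.2 ⟨_, _, hm.adjacent p hp, rfl⟩⟩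
  rw [this]
  exact Set.ncard_image_of_injective _ fun p q h => (rhombus_inj h).1

theorem IsMatching.isFineMixedSubdivision {n : ℕ} {S : Set UnitTriangle}
    (hS : IsHoleArrangement n S) (hn : {p : ℕ × ℕ | p.1 + p.2 + 2 ≤ n}.ncard = n.choose 2)
    {m : ℕ × ℕ → ℕ × ℕ} (hm : IsMatching n S m) : IsFineMixedSubdivision n (tiling n S m) where
  tile := by
    rintro c (⟨t, ht, rfl⟩ | ⟨p, hp, rfl⟩)
    · exact Or.inl ⟨t, (hS.2 t ht).1, rfl⟩
    · exact Or.inr (isRhombus_iff.2 ⟨_, _, hm.adjacent p hp, rfl⟩)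
  inside := by
    rintro c (⟨t, ht, rfl⟩ | ⟨p, hp, rfl⟩) s hs
    · rw [Set.mem_singleton_iff.1 hs]
      exact (hS.2 t ht).2
    · rcases hs with rfl | hs
      · exact inside_down.2 hp
      · rw [Set.mem_singleton_iff.1 hs, inside_up]
        rcases hm.adjacent p hp with h | h | h <;> rw [h] <;> simp only <;> omega
  partition := by
    rintro (⟨a, b⟩ | ⟨a, b⟩) ht
    · rw [inside_up] at ht
      by_cases hab : UnitTriangle.up a b ∈ S
      · refine ⟨{.up a b}, ⟨Or.inl ⟨_, hab, rfl⟩, rfl⟩, ?_⟩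
        rintro c ⟨⟨t, ht', rfl⟩ | ⟨p, hp, rfl⟩, hc⟩
        · rw [Set.mem_singleton_iff.1 hc]
        · simp only [rhombus, Set.mem_insert_iff, reduceCtorEq, Set.mem_singleton_iff,
            false_or] at hc
          exact absurd (hc ▸ hab) (hm.notMem p hp)
      · obtain ⟨p, hp, hpm⟩ := hm.surj (a, b) ht hab
        refine ⟨rhombus p (m p), ⟨Or.inr ⟨p, hp, rfl⟩, by simp [rhombus, hpm]⟩, ?_⟩
        rintro c ⟨⟨t, ht', rfl⟩ | ⟨q, hq, rfl⟩, hc⟩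
        · exact absurd (Set.mem_singleton_iff.1 hc ▸ ht') hab
        · simp only [rhombus, Set.mem_insert_iff, reduceCtorEq, Set.mem_singleton_iff,
            false_or, UnitTriangle.up.injEq] at hc
          rw [hm.inj q p hq hp (by rw [hpm]; exact (Prod.ext hc.1 hc.2).symm)]
    · rw [inside_down] at ht
      refine ⟨rhombus (a, b) (m (a, b)), ⟨Or.inr ⟨_, ht, rfl⟩, by simp [rhombus]⟩, ?_⟩
      rintro c ⟨⟨t, ht', rfl⟩ | ⟨q, hq, rfl⟩, hc⟩
      · rw [← Set.mem_singleton_iff.1 hc] at ht'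
        exact absurd (hS.2 _ ht').1 id
      · simp only [rhombus, Set.mem_insert_iff, reduceCtorEq, Set.mem_singleton_iff,
          or_false, UnitTriangle.down.injEq] at hc
        rw [show q = (a, b) from (Prod.ext hc.1 hc.2).symm]
  card_upTile := by
    have : {c | c ∈ tiling n S m ∧ IsUpTile c} = (fun t => {t}) '' S := by
      ext c
      constructor
      · rintro ⟨⟨t, ht, rfl⟩ | ⟨p, hp, rfl⟩, hr⟩
        · exact ⟨t, ht, rfl⟩
        · exact absurd hr (not_isUpTile_rhombus _ _)
      · rintro ⟨t, ht, rfl⟩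
        exact ⟨Or.inl ⟨t, ht, rfl⟩, t, (hS.2 t ht).1, rfl⟩
    rw [this, Set.ncard_image_of_injective _ Set.singleton_injective, hS.1]
  card_rhombus := by
    rw [ncard_rhombi_tiling (fun t ht => (hS.2 t ht).1) hm, hn]

theorem holes_tiling (n : ℕ) (S : Set UnitTriangle) (m : ℕ × ℕ → ℕ × ℕ) :
    holes (tiling n S m) = S := by
  ext t
  constructor
  · rintro (⟨s, hs, h⟩ | ⟨p, hp, h⟩)
    · rwa [Set.singleton_injective h]
    · have h1 : UnitTriangle.down p.1 p.2 ∈ ({t} : Set UnitTriangle) := h ▸ Set.mem_insert _ _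
      have h2 : UnitTriangle.up (m p).1 (m p).2 ∈ ({t} : Set UnitTriangle) :=
        h ▸ Set.mem_insert_of_mem _ (Set.mem_singleton _)
      rw [Set.mem_singleton_iff] at h1 h2
      rw [← h1] at h2
      exact absurd h2 (by simp)
  · intro ht
    exact Or.inl ⟨t, ht, rfl⟩

/-- Every fine mixed subdivision is given by a matching. -/
theorem IsFineMixedSubdivision.exists_matching {n : ℕ} {S : Set UnitTriangle}
    {C : Set (Set UnitTriangle)} (hC : IsFineMixedSubdivision n C) (hholes : holes C = S) :
    ∃ m, IsMatching n S m ∧ C = tiling n S m := by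
  have hex : ∀ p : ℕ × ℕ, p.1 + p.2 + 2 ≤ n → ∃ u, Adjacent p u ∧ rhombus p u ∈ C := by
    intro p hp
    obtain ⟨c, ⟨hc, hpc⟩, -⟩ := hC.partition (.down p.1 p.2) (inside_down.2 hp)
    rcases hC.tile c hc with ⟨t, ht, rfl⟩ | hr
    · rw [← Set.mem_singleton_iff.1 hpc] at ht
      exact absurd ht id
    · obtain ⟨q, u, hqu, rfl⟩ := isRhombus_iff.1 hr
      simp only [rhombus, Set.mem_insert_iff, reduceCtorEq, Set.mem_singleton_iff,
        or_false, UnitTriangle.down.injEq] at hpc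
      obtain rfl : p = q := Prod.ext hpc.1 hpc.2
      exact ⟨u, hqu, hc⟩
  choose! m hm1 hm2 using hex
  have hpart : ∀ t : UnitTriangle, ∀ c ∈ C, ∀ c' ∈ C, t ∈ c → t ∈ c' → c = c' := by
    intro t c hc c' hc' ht ht'
    exact (hC.partition t (hC.inside c hc t ht)).unique ⟨hc, ht⟩ ⟨hc', ht'⟩
  have hcover : ∀ p u, Adjacent p u → rhombus p u ∈ C → p.1 + p.2 + 2 ≤ n ∧ m p = u := by
    intro p u hpu hc
    have hp := inside_down.1 (hC.inside _ hc (.down p.1 p.2) (Set.mem_insert _ _))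
    refine ⟨hp, ?_⟩
    exact (rhombus_inj (hpart (.down p.1 p.2) _ (hm2 p hp) _ hc (Set.mem_insert _ _)
      (Set.mem_insert _ _))).2
  refine ⟨m, ⟨hm1, ?_, ?_, ?_⟩, ?_⟩
  · intro p hp h
    rw [← hholes] at h
    have := hpart (.up (m p).1 (m p).2) _ h _ (hm2 p hp) rfl
      (Set.mem_insert_of_mem _ (Set.mem_singleton _))
    exact not_isUpTile_rhombus p (m p) ⟨.up (m p).1 (m p).2, trivial, this.symm⟩
  · intro p q hp hq h
    refine (rhombus_inj (hpart (.up (m p).1 (m p).2) _ (hm2 p hp) _ (hm2 q hq)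
      (Set.mem_insert_of_mem _ (Set.mem_singleton _)) ?_)).1
    rw [h]
    exact Set.mem_insert_of_mem _ (Set.mem_singleton _)
  · intro u hu huS
    obtain ⟨c, ⟨hc, huc⟩, -⟩ := hC.partition (.up u.1 u.2) (inside_up.2 hu)
    rcases hC.tile c hc with ⟨t, ht, rfl⟩ | hr
    · rw [← Set.mem_singleton_iff.1 huc] at hc
      rw [← hholes] at huS
      exact absurd hc huS
    · obtain ⟨p, v, hpv, rfl⟩ := isRhombus_iff.1 hr
      simp only [rhombus, Set.mem_insert_iff, reduceCtorEq, Set.mem_singleton_iff,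
        false_or, UnitTriangle.up.injEq] at huc
      obtain rfl : u = v := Prod.ext huc.1 huc.2
      exact ⟨p, hcover p u hpv hc⟩
  · ext c
    constructor
    · intro hc
      rcases hC.tile c hc with ⟨t, ht, rfl⟩ | hr
      · left
        refine ⟨t, ?_, rfl⟩
        rw [← hholes]
        exact hc
      · obtain ⟨p, u, hpu, rfl⟩ := isRhombus_iff.1 hr
        obtain ⟨hp, rfl⟩ := hcover p u hpu hc
        exact Or.inr ⟨p, hp, rfl⟩
    · rintro (⟨t, ht, rfl⟩ | ⟨p, hp, rfl⟩)
      · rw [← hholes] at ht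
        exact ht
      · exact hm2 p hp

/-! ### Uniqueness excludes alternating cycles and closed walks -/

/-- If the tiling is the only one with its holes, then its matching has no alternating cycle. -/
theorem not_exists_alternating {n : ℕ} {S : Set UnitTriangle} (hS : IsHoleArrangement n S)
    {C : Set (Set UnitTriangle)} (hC : IsFineMixedSubdivision n C)
    (hunique : ∀ C' : Set (Set UnitTriangle),
      IsFineMixedSubdivision n C' → holes C' = S → C' = C)
    {m : ℕ × ℕ → ℕ × ℕ} (hm : IsMatching n S m) (hCm : C = tiling n S m)
    {A : Set (ℕ × ℕ)} (hA : A.Nonempty) (hAn : ∀ p ∈ A, p.1 + p.2 + 2 ≤ n)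
    (hsucc : ∀ p ∈ A, ∃ q ∈ A, Adjacent q (m p) ∧ q ≠ p) : False := by
  classical
  choose! g hgA hgadj hgne using hsucc
  have hfin : A.Finite := by
    refine ((Set.finite_Iic n).prod (Set.finite_Iic n)).subset fun p hp => ?_
    have := hAn p hp
    simp only [Set.mem_prod, Set.mem_Iic]
    omega
  obtain ⟨p₀, hp₀⟩ := hA
  obtain ⟨q₀, hq₀, hq₀'⟩ := exists_periodicPt hfin hgA hp₀
  -- On these periodic points `g` is a permutation, whose cycles alternate between matched and
  -- unmatched adjacent pairs.
  set Q := A ∩ Function.periodicPts g with hQ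
  have hbij0 := Function.bijOn_periodicPts g
  have hbij : Set.BijOn g Q Q := by
    refine ⟨fun p hp => ⟨hgA p hp.1, hbij0.mapsTo hp.2⟩, hbij0.injOn.mono fun p hp => hp.2, ?_⟩
    rintro q ⟨hq, hq'⟩
    obtain ⟨p, hp, rfl⟩ := hbij0.surjOn hq'
    refine ⟨p, ⟨?_, hp⟩, rfl⟩
    obtain ⟨k, hk, hpk⟩ := hp
    obtain ⟨k, rfl⟩ := Nat.exists_eq_succ_of_ne_zero hk.ne'
    have : g^[k] (g p) = p := hpk
    rw [← this]
    exact Set.MapsTo.iterate hgA k hq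
  set r := Function.invFunOn g Q with hr
  have hinv : Set.InvOn r g Q Q := hbij.invOn_invFunOn
  have hrQ : ∀ q ∈ Q, r q ∈ Q := fun q hq => hbij.surjOn.mapsTo_invFunOn hq
  -- The flip hands the partner of `q` over to `g q`, so the new matching is `m` composed with the
  -- inverse of `g` on `Q`.
  set σ : ℕ × ℕ → ℕ × ℕ := fun q => if q ∈ Q then r q else q with hσ
  have hσ1 : ∀ q ∈ Q, σ q = r q := fun q hq => if_pos hq
  have hσ2 : ∀ q, q ∉ Q → σ q = q := fun q hq => if_neg hq
  have hσn : ∀ p : ℕ × ℕ, p.1 + p.2 + 2 ≤ n → (σ p).1 + (σ p).2 + 2 ≤ n := by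
    intro p hp
    by_cases h : p ∈ Q
    · rw [hσ1 p h]
      exact hAn _ (hrQ p h).1
    · rwa [hσ2 p h]
  have hm' : IsMatching n S (m ∘ σ) := by
    refine ⟨?_, fun p hp => hm.notMem _ (hσn p hp), ?_, ?_⟩
    · intro p hp
      by_cases h : p ∈ Q
      · have := hgadj (r p) (hrQ p h).1
        rw [hinv.2 h] at this
        simpa only [Function.comp_apply, hσ1 p h] using this
      · simpa only [Function.comp_apply, hσ2 p h] using hm.adjacent p hp
    · intro p q hp hq h
      have h := hm.inj _ _ (hσn p hp) (hσn q hq) h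
      by_cases h1 : p ∈ Q <;> by_cases h2 : q ∈ Q
      · rw [hσ1 p h1, hσ1 q h2] at h
        rw [← hinv.2 h1, ← hinv.2 h2, h]
      · rw [hσ1 p h1, hσ2 q h2] at h
        exact absurd (h ▸ hrQ p h1) h2
      · rw [hσ2 p h1, hσ1 q h2] at h
        exact absurd (h ▸ hrQ q h2) h1
      · rwa [hσ2 p h1, hσ2 q h2] at h
    · intro u hu huS
      obtain ⟨p, hp, rfl⟩ := hm.surj u hu huS
      by_cases h : p ∈ Q
      · refine ⟨g p, hAn _ (hgA p h.1), ?_⟩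
        rw [Function.comp_apply, hσ1 _ (hbij.mapsTo h), hinv.1 h]
      · exact ⟨p, hp, by rw [Function.comp_apply, hσ2 p h]⟩
  -- The count of down triangles is read off from the rhombi of `C`.
  have hn : {p : ℕ × ℕ | p.1 + p.2 + 2 ≤ n}.ncard = n.choose 2 := by
    rw [← ncard_rhombi_tiling (fun t ht => (hS.2 t ht).1) hm, ← hCm]
    exact hC.card_rhombus
  have heq := hunique _ (hm'.isFineMixedSubdivision hS hn) (holes_tiling _ _ _)
  have hq₀Q : q₀ ∈ Q := ⟨hq₀, hq₀'⟩
  have hmem : rhombus (g q₀) (m q₀) ∈ tiling n S m := by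
    rw [← hCm, ← heq]
    refine Or.inr ⟨g q₀, hAn _ (hgA q₀ hq₀), ?_⟩
    rw [Function.comp_apply, hσ1 _ (hbij.mapsTo hq₀Q), hinv.1 hq₀Q]
  rcases hmem with ⟨t, ht, h⟩ | ⟨p, hp, h⟩
  · exact not_isUpTile_rhombus _ _ ⟨t, (hS.2 t ht).1, h⟩
  · obtain ⟨h1, h2⟩ := rhombus_inj h
    have := hm.inj _ _ (hAn q₀ hq₀) hp h2
    exact hgne q₀ hq₀ (h1.trans this.symm)

/-- There are no closed walks without sharp turns that do not run through the interior of a rhombus: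
the tiles around which they have maximal winding number would contain an alternating cycle. -/
theorem not_exists_closed_walks {n : ℕ} {S : Set UnitTriangle} (hS : IsHoleArrangement n S)
    {C : Set (Set UnitTriangle)} (hC : IsFineMixedSubdivision n C)
    (hunique : ∀ C' : Set (Set UnitTriangle),
      IsFineMixedSubdivision n C' → holes C' = S → C' = C)
    {m : ℕ × ℕ → ℕ × ℕ} (hm : IsMatching n S m) (hCm : C = tiling n S m)
    {Z : Set (ℤ × ℤ)} {o : ℤ × ℤ → ℤ × ℤ} (hne : Z.Nonempty)
    (hint : ∀ p ∈ Z, 1 ≤ p.1 ∧ 1 ≤ p.2 ∧ p.1 + p.2 + 1 ≤ n)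
    (hdir : ∀ p ∈ Z, o p ∈ directions) (hnext : ∀ p ∈ Z, p + o p ∈ Z)
    (hsharp : ∀ p ∈ Z, (o p, o (p + o p)) ∉ sharpTurns) (hback : ∀ p ∈ Z, o (p + o p) ≠ -o p)
    (hinj : ∀ p ∈ Z, ∀ q ∈ Z, p + o p = q + o q → p = q)
    (hsurj : ∀ q ∈ Z, ∃ p ∈ Z, p + o p = q)
    (hS1 : ∀ i j : ℕ, m (i, j) = (i, j) →
      ¬ (((i : ℤ) + 1, (j : ℤ)) ∈ Z ∧ o ((i : ℤ) + 1, (j : ℤ)) = (-1, 1)) ∧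
      ¬ (((i : ℤ), (j : ℤ) + 1) ∈ Z ∧ o ((i : ℤ), (j : ℤ) + 1) = (1, -1)))
    (hH1 : ∀ i j : ℕ, m (i, j) = (i, j + 1) →
      ¬ (((i : ℤ), (j : ℤ) + 1) ∈ Z ∧ o ((i : ℤ), (j : ℤ) + 1) = (1, 0)) ∧
      ¬ (((i : ℤ) + 1, (j : ℤ) + 1) ∈ Z ∧ o ((i : ℤ) + 1, (j : ℤ) + 1) = (-1, 0)))
    (hV1 : ∀ i j : ℕ, m (i, j) = (i + 1, j) →
      ¬ (((i : ℤ) + 1, (j : ℤ)) ∈ Z ∧ o ((i : ℤ) + 1, (j : ℤ)) = (0, 1)) ∧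
      ¬ (((i : ℤ) + 1, (j : ℤ) + 1) ∈ Z ∧ o ((i : ℤ) + 1, (j : ℤ) + 1) = (0, -1))) : False := by
  obtain ⟨U, D, eS, eH, eV, hb0, ha0, hout, hSH, hSV, hHV, hex⟩ :=
    exists_winding hne hint hdir hnext hsharp hback hinj hsurj
  have hDin : ∀ a b, D a b ≠ 0 → a + b + 2 ≤ n := by
    intro a b h
    by_contra hlt
    exact h (hout a b (by omega)).2
  have hUin : ∀ a b, U a b ≠ 0 → a + b + 2 ≤ n ∧ a ≠ 0 ∧ b ≠ 0 := by
    intro a b h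
    refine ⟨?_, ?_, ?_⟩
    · by_contra hlt
      exact h (hout a b (by omega)).1
    · rintro rfl
      exact h (ha0 b)
    · rintro rfl
      exact h (hb0 a)
  -- At least two of the three down neighbours have the same winding number as the up triangle, so
  -- one of them is not `p`.
  have hnb : ∀ a b, U a b ≠ 0 → ∀ p : ℕ × ℕ, ∃ q : ℕ × ℕ, D q.1 q.2 ≠ 0 ∧ Adjacent q (a, b) ∧
      q ≠ p := by
    intro a b h p
    obtain ⟨-, h1, h2⟩ := hUin a b h
    obtain ⟨a, rfl⟩ := Nat.exists_eq_succ_of_ne_zero h1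
    obtain ⟨b, rfl⟩ := Nat.exists_eq_succ_of_ne_zero h2
    have kSH := hSH (a + 1) (b + 1)
    have kSV := hSV (a + 1) (b + 1)
    have kHV := hHV (a + 1) (b + 1)
    simp only [Nat.succ_eq_add_one, Nat.add_eq_zero_iff, one_ne_zero, and_false, false_or,
      Nat.add_sub_cancel] at kSH kSV kHV h ⊢
    have two : ∀ q q' : ℕ × ℕ, q ≠ q' → D q.1 q.2 ≠ 0 → D q'.1 q'.2 ≠ 0 →
        Adjacent q (a + 1, b + 1) → Adjacent q' (a + 1, b + 1) →
        ∃ q : ℕ × ℕ, D q.1 q.2 ≠ 0 ∧ Adjacent q (a + 1, b + 1) ∧ q ≠ p := by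
      intro q q' hqq hq hq' hqa hqa'
      by_cases hqp : q = p
      · exact ⟨q', hq', hqa', fun h => hqq (hqp.trans h.symm)⟩
      · exact ⟨q, hq, hqa, hqp⟩
    have aS : Adjacent (a + 1, b + 1) (a + 1, b + 1) := Or.inl rfl
    have aH : Adjacent (a + 1, b) (a + 1, b + 1) := Or.inr (Or.inl rfl)
    have aV : Adjacent (a, b + 1) (a + 1, b + 1) := Or.inr (Or.inr rfl)
    by_cases kS : U (a + 1) (b + 1) = D (a + 1) (b + 1)
    · rcases kHV with k | k
      · exact two _ _ (by simp) (kS ▸ h) (k ▸ h) aS aH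
      · exact two _ _ (by simp) (kS ▸ h) (k ▸ h) aS aV
    · have k := kSH.resolve_left kS
      have k' := kSV.resolve_left kS
      refine two (a + 1, b) (a, b + 1) (by simp) ?_ ?_ aH aV
      · exact k ▸ h
      · exact k' ▸ h
  have hne' : ∃ a b, D a b ≠ 0 := by
    obtain ⟨a, b, h | h⟩ := hex
    · obtain ⟨q, hq, -⟩ := hnb a b h (0, 0)
      exact ⟨_, _, hq⟩
    · exact ⟨a, b, h⟩
  obtain ⟨a, b, hab⟩ := hne'
  -- It is enough that the winding number is nonzero: it passes from a down triangle to its partner,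
  -- since the walks avoid short diagonals, and by `hnb` on to another down triangle.
  refine not_exists_alternating hS hC hunique hm hCm (A := {p | D p.1 p.2 ≠ 0}) ⟨(a, b), hab⟩
    (fun p hp => hDin _ _ hp) ?_
  rintro ⟨i, j⟩ hp
  have hU : U (m (i, j)).1 (m (i, j)).2 ≠ 0 := by
    rcases hm.adjacent (i, j) (hDin _ _ hp) with h | h | h
    · rw [h]
      rw [eS i j (hS1 i j h)]
      exact hp
    · rw [h]
      rw [eH i j (hH1 i j h)]
      exact hp
    · rw [h]
      rw [eV i j (hV1 i j h)]
      exact hp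
  obtain ⟨q, hq, hqa, hqp⟩ := hnb _ _ hU (i, j)
  exact ⟨q, hq, hqa, hqp⟩

/-- The vector field `(x, y)` vanishes if it is zero at the boundary and contracts no edge of the
unique tiling. -/
theorem eq_zero_of_not_contracting {n : ℕ} {S : Set UnitTriangle} (hS : IsHoleArrangement n S)
    {C : Set (Set UnitTriangle)} (hC : IsFineMixedSubdivision n C)
    (hunique : ∀ C' : Set (Set UnitTriangle),
      IsFineMixedSubdivision n C' → holes C' = S → C' = C)
    {m : ℕ × ℕ → ℕ × ℕ} (hm : IsMatching n S m) (hCm : C = tiling n S m) (x y : ℕ → ℕ → ℝ)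
    (hxy : ∀ a b, ¬ (1 ≤ a ∧ 1 ≤ b ∧ a + b + 1 ≤ n) → x a b = 0 ∧ y a b = 0)
    (hmono : ∀ i j, i + j + 2 ≤ n →
      (m (i, j) ≠ (i, j) → y (i + 1) j - x (i + 1) j ≤ y i (j + 1) - x i (j + 1)) ∧
      (m (i, j) ≠ (i, j + 1) → x i (j + 1) ≤ x (i + 1) (j + 1)) ∧
      (m (i, j) ≠ (i + 1, j) → y (i + 1) j ≤ y (i + 1) (j + 1))) (a b : ℕ) :
    x a b = 0 ∧ y a b = 0 := by
  by_contra hab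
  set X : ℤ × ℤ → ℝ := fun p => if 0 ≤ p.1 ∧ 0 ≤ p.2 then x p.1.toNat p.2.toNat else 0 with hX
  set Y : ℤ × ℤ → ℝ := fun p => if 0 ≤ p.1 ∧ 0 ≤ p.2 then y p.1.toNat p.2.toNat else 0 with hY
  have hXn : ∀ a b : ℕ, X (a, b) = x a b := fun a b => by simp [hX]
  have hYn : ∀ a b : ℕ, Y (a, b) = y a b := fun a b => by simp [hY]
  have hsupp : ∀ p, (X p ≠ 0 ∨ Y p ≠ 0) →
      ∃ a b : ℕ, p = ((a : ℤ) + 1, (b : ℤ) + 1) ∧ a + b + 3 ≤ n := by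
    rintro ⟨p, q⟩ h
    by_cases hpq : 0 ≤ p ∧ 0 ≤ q
    · obtain ⟨p, rfl⟩ := Int.eq_ofNat_of_zero_le hpq.1
      obtain ⟨q, rfl⟩ := Int.eq_ofNat_of_zero_le hpq.2
      rw [hXn, hYn] at h
      have : 1 ≤ p ∧ 1 ≤ q ∧ p + q + 1 ≤ n := by
        by_contra hn
        have := hxy p q hn
        tauto
      exact ⟨p - 1, q - 1, by simp only [Prod.mk.injEq]; omega, by omega⟩
    · simp [hX, hY, hpq] at h
  -- `E p u` says that the edge from `p` to `p + u` is the short diagonal of a rhombus. The shift by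
  -- one is harmless because only interior vertices `(a + 1, b + 1)` matter.
  let E : ℤ × ℤ → ℤ × ℤ → Prop := fun p u =>
    let a := (p.1 - 1).toNat
    let b := (p.2 - 1).toNat
    (u = (1, 0) ∧ m (a + 1, b) = (a + 1, b + 1)) ∨
    (u = (0, 1) ∧ m (a, b + 1) = (a + 1, b + 1)) ∨
    (u = (-1, 1) ∧ m (a, b + 1) = (a, b + 1)) ∨
    (u = (-1, 0) ∧ m (a, b) = (a, b + 1)) ∨
    (u = (0, -1) ∧ m (a, b) = (a + 1, b)) ∨
    (u = (1, -1) ∧ m (a + 1, b) = (a + 1, b))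
  have hE : ∀ (a b : ℕ) (u : ℤ × ℤ), E ((a : ℤ) + 1, (b : ℤ) + 1) u ↔
      (u = (1, 0) ∧ m (a + 1, b) = (a + 1, b + 1)) ∨
      (u = (0, 1) ∧ m (a, b + 1) = (a + 1, b + 1)) ∨
      (u = (-1, 1) ∧ m (a, b + 1) = (a, b + 1)) ∨
      (u = (-1, 0) ∧ m (a, b) = (a, b + 1)) ∨
      (u = (0, -1) ∧ m (a, b) = (a + 1, b)) ∨
      (u = (1, -1) ∧ m (a + 1, b) = (a + 1, b)) := by
    intro a b u
    simp [E]
  have hfin : {p | X p ≠ 0 ∨ Y p ≠ 0}.Finite := by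
    refine ((Set.finite_Icc (0 : ℤ) n).prod (Set.finite_Icc (0 : ℤ) n)).subset fun p hp => ?_
    obtain ⟨a, b, rfl, h⟩ := hsupp p hp
    simp only [Set.mem_prod, Set.mem_Icc]
    omega
  have hne : {p | X p ≠ 0 ∨ Y p ≠ 0}.Nonempty := by
    refine ⟨(a, b), ?_⟩
    rw [not_and_or] at hab
    show X (a, b) ≠ 0 ∨ Y (a, b) ≠ 0
    rwa [hXn, hYn]
  obtain ⟨Z, o, hZ, hZo, hinj, hsurj⟩ := exists_closed_walks E hfin hne (by
    intro p hp u hu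
    obtain ⟨a, b, rfl, hab⟩ := hsupp p hp
    simp only [directions, Finset.mem_insert, Finset.mem_singleton] at hu
    rw [hE, hE]
    -- Neighbouring edges at `p` bound a unit triangle that would lie in two rhombi. If it points
    -- up, this contradicts injectivity of `m`; if it points down, it would have two partners.
    rcases hu with rfl | rfl | rfl | rfl | rfl | rfl <;> simp [rotate60] <;> intro h1 h2
    · have := hm.inj (a + 1, b) (a, b + 1) (by simp only; omega) (by simp only; omega)
        (h1.trans h2.symm)
      simp at this
    · simp [h1] at h2
    · have := hm.inj (a, b + 1) (a, b) (by simp only; omega) (by simp only; omega)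
        (h1.trans h2.symm)
      simp at this
    · simp [h1] at h2
    · have := hm.inj (a, b) (a + 1, b) (by simp only; omega) (by simp only; omega)
        (h1.trans h2.symm)
      simp at this
    · simp [h1] at h2) (by
    intro p hp u hu hE'
    obtain ⟨a, b, rfl, hab⟩ := hsupp p hp
    rw [hE] at hE'
    have c00 : X ((a : ℤ) + 1, (b : ℤ) + 1) = x (a + 1) (b + 1) ∧
      Y ((a : ℤ) + 1, (b : ℤ) + 1) = y (a + 1) (b + 1) := by
      exact_mod_cast And.intro (hXn (a + 1) (b + 1)) (hYn (a + 1) (b + 1))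
    have k1 := hmono (a + 1) b (by omega)
    have k2 := hmono a (b + 1) (by omega)
    have k3 := hmono a b (by omega)
    simp only [directions, Finset.mem_insert, Finset.mem_singleton] at hu
    rcases hu with rfl | rfl | rfl | rfl | rfl | rfl <;> simp at hE' <;>
      simp only [Prod.mk_add_mk, add_zero, c00.1, c00.2, ← sub_eq_add_neg, add_sub_cancel_right]
    · have := k1.2.1 hE'
      rw [show (((a : ℤ) + 1 + 1, (b : ℤ) + 1) : ℤ × ℤ) = (((a + 2 : ℕ) : ℤ), ((b + 1 : ℕ) : ℤ)) by
        push_cast; congr 1, hXn, hYn]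
      simp
      exact this
    · have := k2.2.2 hE'
      rw [show (((a : ℤ) + 1, (b : ℤ) + 1 + 1) : ℤ × ℤ) = (((a + 1 : ℕ) : ℤ), ((b + 2 : ℕ) : ℤ)) by
        push_cast; congr 1, hXn, hYn]
      simp
      exact this
    · have := k2.1 hE'
      rw [show (((a : ℤ), (b : ℤ) + 1 + 1) : ℤ × ℤ) = (((a : ℕ) : ℤ), ((b + 2 : ℕ) : ℤ)) by
        push_cast; congr 1, hXn, hYn]
      push_cast
      linarith
    · have := k3.2.1 hE'
      rw [show (((a : ℤ), (b : ℤ) + 1) : ℤ × ℤ) = (((a : ℕ) : ℤ), ((b + 1 : ℕ) : ℤ)) by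
        push_cast; rfl, hXn, hYn]
      push_cast
      linarith
    · have := k3.2.2 hE'
      rw [show (((a : ℤ) + 1, (b : ℤ)) : ℤ × ℤ) = (((a + 1 : ℕ) : ℤ), ((b : ℕ) : ℤ)) by
        push_cast; rfl, hXn, hYn]
      push_cast
      linarith
    · have := k1.1 hE'
      rw [show (((a : ℤ) + 1 + 1, (b : ℤ)) : ℤ × ℤ) = (((a + 2 : ℕ) : ℤ), ((b : ℕ) : ℤ)) by
        push_cast; congr 1, hXn, hYn]
      push_cast
      linarith)
  have hZE : ∀ p ∈ Z, ∀ u, E p u → o p ≠ u := by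
    rintro p hp _ hEu rfl
    exact (hZo p hp).2.2.1 hEu
  have hZin : ∀ p ∈ Z, 1 ≤ p.1 ∧ 1 ≤ p.2 ∧ p.1 + p.2 + 1 ≤ n := by
    intro p hp
    obtain ⟨a, b, rfl, h⟩ := hsupp p (hZo p hp).1
    simp only
    omega
  refine not_exists_closed_walks hS hC hunique hm hCm hZ hZin (fun p hp => (hZo p hp).2.1)
    (fun p hp => (hZo p hp).2.2.2.1) (fun p hp => (hZo p hp).2.2.2.2.1)
    (fun p hp => (hZo p hp).2.2.2.2.2) hinj hsurj ?_ ?_ ?_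
  · intro i j h
    constructor
    · rintro ⟨hp, ho⟩
      have := hZin _ hp
      obtain ⟨j, rfl⟩ : ∃ k : ℕ, j = k + 1 := ⟨j - 1, by simp only at this; omega⟩
      push_cast at hp ho
      exact hZE _ hp _ ((hE i j _).2 (by simp [h])) ho
    · rintro ⟨hp, ho⟩
      have := hZin _ hp
      obtain ⟨i, rfl⟩ : ∃ k : ℕ, i = k + 1 := ⟨i - 1, by simp only at this; omega⟩
      push_cast at hp ho
      exact hZE _ hp _ ((hE i j _).2 (by simp [h])) ho
  · intro i j h
    constructor
    · rintro ⟨hp, ho⟩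
      have := hZin _ hp
      obtain ⟨i, rfl⟩ : ∃ k : ℕ, i = k + 1 := ⟨i - 1, by simp only at this; omega⟩
      push_cast at hp ho
      exact hZE _ hp _ ((hE i j _).2 (by simp [h])) ho
    · rintro ⟨hp, ho⟩
      exact hZE _ hp _ ((hE i j _).2 (by simp [h])) ho
  · intro i j h
    constructor
    · rintro ⟨hp, ho⟩
      have := hZin _ hp
      obtain ⟨j, rfl⟩ : ∃ k : ℕ, j = k + 1 := ⟨j - 1, by simp only at this; omega⟩
      push_cast at hp ho
      exact hZE _ hp _ ((hE i j _).2 (by simp [h])) ho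
    · rintro ⟨hp, ho⟩
      exact hZE _ hp _ ((hE i j _).2 (by simp [h])) ho

/-! ### Lattice coordinates in the plane -/

/-- The first lattice coordinate of a point of the plane. -/
noncomputable def coordX : Plane →ₗ[ℝ] ℝ :=
  LinearMap.fst ℝ ℝ ℝ - (1 / Real.sqrt 3) • LinearMap.snd ℝ ℝ ℝ

/-- The second lattice coordinate of a point of the plane. -/
noncomputable def coordY : Plane →ₗ[ℝ] ℝ := (2 / Real.sqrt 3) • LinearMap.snd ℝ ℝ ℝ

theorem eq_of_coords {p q : Plane} (hX : coordX p = coordX q) (hY : coordY p = coordY q) :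
    p = q := by
  have h3 : Real.sqrt 3 ≠ 0 := by positivity
  simp only [coordX, coordY, LinearMap.sub_apply, LinearMap.smul_apply, LinearMap.fst_apply,
    LinearMap.snd_apply, smul_eq_mul] at hX hY
  have h2 : p.2 = q.2 := mul_left_cancel₀ (by positivity) hY
  rw [h2] at hX
  exact Prod.ext (by linarith) h2

theorem coordX_mk (x y : ℝ) : coordX (x + y / 2, Real.sqrt 3 / 2 * y) = x := by
  have h3 : Real.sqrt 3 ≠ 0 := by positivity
  simp only [coordX, LinearMap.sub_apply, LinearMap.smul_apply, LinearMap.fst_apply,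
    LinearMap.snd_apply, smul_eq_mul]
  field_simp
  ring

theorem coordY_mk (x y : ℝ) : coordY (x + y / 2, Real.sqrt 3 / 2 * y) = y := by
  have h3 : Real.sqrt 3 ≠ 0 := by positivity
  simp only [coordY, LinearMap.smul_apply, LinearMap.snd_apply, smul_eq_mul]
  field_simp

@[simp]
theorem coordX_gridPoint (v : ℕ × ℕ) : coordX (gridPoint v) = v.1 := coordX_mk _ _

@[simp]
theorem coordY_gridPoint (v : ℕ × ℕ) : coordY (gridPoint v) = v.2 := coordY_mk _ _

theorem mem_upwardTriangle {a b k : ℕ} (hk : 0 < k) {p : Plane} (ha : a ≤ coordX p)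
    (hb : b ≤ coordY p) (hab : coordX p + coordY p ≤ a + b + k) : p ∈ upwardTriangle a b k := by
  have hk' : (0 : ℝ) < k := by exact_mod_cast hk
  have hp : p = (1 - (coordX p - a) / k - (coordY p - b) / k) • gridPoint (a, b)
      + ((coordX p - a) / k) • gridPoint (a + k, b)
      + ((coordY p - b) / k) • gridPoint (a, b + k) := by
    apply eq_of_coords
    · simp only [map_add, map_smul, coordX_gridPoint, smul_eq_mul]
      push_cast
      field_simp
      ring
    · simp only [map_add, map_smul, coordY_gridPoint, smul_eq_mul]
      push_cast
      field_simp
      ring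
  rw [hp, upwardTriangle, Set.image_insert_eq, Set.image_insert_eq, Set.image_singleton]
  refine mem_convexHull_triangle ?_ (div_nonneg (by linarith) hk'.le)
    (div_nonneg (by linarith) hk'.le) (by ring)
  rw [sub_sub, ← add_div, sub_nonneg, div_le_one hk']
  linarith

theorem region_up (a b : ℕ) : (UnitTriangle.up a b).region = upwardTriangle a b 1 := by
  simp [UnitTriangle.region, upwardTriangle, UnitTriangle.vertices]

theorem mem_region_down {a b : ℕ} {p : Plane} (ha : coordX p ≤ a + 1) (hb : coordY p ≤ b + 1)
    (hab : a + b + 1 ≤ coordX p + coordY p) : p ∈ (UnitTriangle.down a b).region := by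
  have hp : p = (b + 1 - coordY p) • gridPoint (a + 1, b)
      + (a + 1 - coordX p) • gridPoint (a, b + 1)
      + (coordX p + coordY p - a - b - 1) • gridPoint (a + 1, b + 1) := by
    apply eq_of_coords
    · simp only [map_add, map_smul, coordX_gridPoint, smul_eq_mul]
      push_cast
      ring
    · simp only [map_add, map_smul, coordY_gridPoint, smul_eq_mul]
      push_cast
      ring
  have hv : (gridPoint '' ((UnitTriangle.down a b).vertices : Set (ℕ × ℕ)))
      = {gridPoint (a + 1, b), gridPoint (a, b + 1), gridPoint (a + 1, b + 1)} := by
    simp [UnitTriangle.vertices, Set.image_insert_eq]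
  rw [UnitTriangle.region, hv, hp]
  exact mem_convexHull_triangle (by linarith) (by linarith) (by linarith) (by ring)

theorem interior_region_up_nonempty (a b : ℕ) :
    (interior (UnitTriangle.up a b).region).Nonempty := by
  have hX : Continuous coordX := coordX.continuous_of_finiteDimensional
  have hY : Continuous coordY := coordY.continuous_of_finiteDimensional
  have hopen : IsOpen {p : Plane | (a : ℝ) < coordX p ∧ (b : ℝ) < coordY p ∧
      coordX p + coordY p < a + b + 1} :=
    (isOpen_lt continuous_const hX).inter ((isOpen_lt continuous_const hY).inter
      (isOpen_lt (hX.add hY) continuous_const))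
  have hsub : {p : Plane | (a : ℝ) < coordX p ∧ (b : ℝ) < coordY p ∧
      coordX p + coordY p < a + b + 1} ⊆ (UnitTriangle.up a b).region := by
    rintro p ⟨h1, h2, h3⟩
    rw [region_up]
    exact mem_upwardTriangle one_pos h1.le h2.le (by push_cast; exact h3.le)
  have hmem : (((a + 1 / 4 : ℝ) + (b + 1 / 4 : ℝ) / 2, Real.sqrt 3 / 2 * (b + 1 / 4 : ℝ)) : Plane) ∈
      {p : Plane | (a : ℝ) < coordX p ∧ (b : ℝ) < coordY p ∧
        coordX p + coordY p < a + b + 1} := by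
    rw [Set.mem_ofPred_eq, coordX_mk, coordY_mk]
    refine ⟨by linarith, by linarith, by linarith⟩
  exact ⟨_, interior_maximal hsub hopen hmem⟩

theorem coords_of_mem_convexHull {n : ℕ} {p : Plane}
    (hp : p ∈ convexHull ℝ (gridPoint '' {v : ℕ × ℕ | v.1 + v.2 ≤ n})) :
    0 ≤ coordX p ∧ 0 ≤ coordY p ∧ coordX p + coordY p ≤ n := by
  have hconv : Convex ℝ {p : Plane | 0 ≤ coordX p ∧ 0 ≤ coordY p ∧ coordX p + coordY p ≤ n} := by
    rintro x ⟨hx1, hx2, hx3⟩ y ⟨hy1, hy2, hy3⟩ s t hs ht hst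
    simp only [Set.mem_ofPred_eq, map_add, map_smul, smul_eq_mul]
    refine ⟨by positivity, by positivity, ?_⟩
    have h1 := mul_le_mul_of_nonneg_left hx3 hs
    have h2 := mul_le_mul_of_nonneg_left hy3 ht
    have h3 : s * (n : ℝ) + t * n = n := by rw [← add_mul, hst, one_mul]
    linarith
  refine convexHull_min ?_ hconv hp
  rintro _ ⟨v, hv, rfl⟩
  rw [Set.mem_ofPred_eq, coordX_gridPoint, coordY_gridPoint]
  refine ⟨by positivity, by positivity, by exact_mod_cast hv⟩

theorem convexHull_gridPoints (n : ℕ) :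
    convexHull ℝ (gridPoint '' {v : ℕ × ℕ | v.1 + v.2 ≤ n}) = upwardTriangle 0 0 n := by
  apply Set.Subset.antisymm
  · intro p hp
    rcases Nat.eq_zero_or_pos n with rfl | hn
    · have : {v : ℕ × ℕ | v.1 + v.2 ≤ 0} = {(0, 0)} := by
        ext ⟨a, b⟩
        simp
      rw [this] at hp
      simpa [upwardTriangle] using hp
    · obtain ⟨h1, h2, h3⟩ := coords_of_mem_convexHull hp
      exact mem_upwardTriangle hn (by simpa using h1) (by simpa using h2) (by simpa using h3)
  · refine convexHull_mono (Set.image_mono ?_)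
    rintro v (rfl | rfl | rfl) <;> simp

theorem exists_unitTriangle_of_mem_interior {n : ℕ} {p : Plane}
    (hp : p ∈ interior (convexHull ℝ (gridPoint '' {v : ℕ × ℕ | v.1 + v.2 ≤ n}))) :
    ∃ t : UnitTriangle, t.Inside 0 0 n ∧ p ∈ t.region := by
  obtain ⟨h1, h2, -⟩ := coords_of_mem_convexHull (interior_subset hp)
  -- Strictness needs an interior point: at a grid point on the hypotenuse the integer parts would
  -- select a unit triangle outside.
  have h3 : coordX p + coordY p < n := by
    have hlim : ∀ᶠ t : ℝ in nhds 0, p + t • ((1, 0) : Plane) ∈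
        convexHull ℝ (gridPoint '' {v : ℕ × ℕ | v.1 + v.2 ≤ n}) := by
      have hcont : Filter.Tendsto (fun t : ℝ => p + t • ((1, 0) : Plane)) (nhds 0) (nhds p) := by
        have : Continuous (fun t : ℝ => p + t • ((1, 0) : Plane)) := by fun_prop
        simpa using this.tendsto 0
      exact hcont (mem_interior_iff_mem_nhds.1 hp)
    obtain ⟨ε, hε, hball⟩ := Metric.eventually_nhds_iff.1 hlim
    have := (coords_of_mem_convexHull (hball (y := ε / 2)
      (by rw [Real.dist_eq, sub_zero, abs_of_pos] <;> linarith))).2.2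
    have e1 : coordX ((1, 0) : Plane) = 1 := by simp [coordX]
    have e2 : coordY ((1, 0) : Plane) = 0 := by simp [coordY]
    simp only [map_add, map_smul, e1, e2, smul_eq_mul] at this
    linarith
  have f1 := Nat.floor_le h1
  have f2 := Nat.floor_le h2
  have f3 := Nat.lt_floor_add_one (coordX p)
  have f4 := Nat.lt_floor_add_one (coordY p)
  rcases le_or_gt (coordX p + coordY p) (⌊coordX p⌋₊ + ⌊coordY p⌋₊ + 1) with h | h
  · refine ⟨.up ⌊coordX p⌋₊ ⌊coordY p⌋₊, inside_up.2 ?_, ?_⟩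
    · have : ((⌊coordX p⌋₊ + ⌊coordY p⌋₊ : ℕ) : ℝ) < n := by push_cast; linarith
      have : ⌊coordX p⌋₊ + ⌊coordY p⌋₊ < n := by exact_mod_cast this
      omega
    · rw [region_up]
      exact mem_upwardTriangle one_pos f1 f2 (by push_cast; exact h)
  · refine ⟨.down ⌊coordX p⌋₊ ⌊coordY p⌋₊, inside_down.2 ?_, mem_region_down f3.le f4.le h.le⟩
    have : ((⌊coordX p⌋₊ + ⌊coordY p⌋₊ + 1 : ℕ) : ℝ) < n := by push_cast; linarith
    have : ⌊coordX p⌋₊ + ⌊coordY p⌋₊ + 1 < n := by exact_mod_cast this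
    omega

/-! ### Tiles, their support functions and the conclusion -/

/-- The vertices of a tile. -/
def tileVertices (c : Set UnitTriangle) : Set (ℕ × ℕ) := ⋃ t ∈ c, (t.vertices : Set (ℕ × ℕ))

theorem region_subset_convexHull {c : Set UnitTriangle} {t : UnitTriangle} (ht : t ∈ c) :
    t.region ⊆ convexHull ℝ (gridPoint '' tileVertices c) :=
  convexHull_mono (Set.image_mono fun _ hv => Set.mem_biUnion ht hv)

theorem mem_tileVertices_rhombus {p u v : ℕ × ℕ} : v ∈ tileVertices (rhombus p u) ↔
    v ∈ (UnitTriangle.down p.1 p.2).vertices ∨ v ∈ (UnitTriangle.up u.1 u.2).vertices := by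
  simp [tileVertices, rhombus]

theorem mem_tileVertices_singleton {t : UnitTriangle} {v : ℕ × ℕ} :
    v ∈ tileVertices {t} ↔ v ∈ t.vertices := by
  simp [tileVertices]

theorem tileRegion_rhombus {p u : ℕ × ℕ} (h : Adjacent p u) :
    tileRegion (rhombus p u) = convexHull ℝ (gridPoint '' tileVertices (rhombus p u)) := by
  obtain ⟨i, j⟩ := p
  have key : ∀ (u A B C D : ℕ × ℕ),
      (∀ v, v ∈ (UnitTriangle.up u.1 u.2).vertices ↔ v = A ∨ v = B ∨ v = C) →
      (∀ v, v ∈ (UnitTriangle.down i j).vertices ↔ v = D ∨ v = B ∨ v = C) →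
      A.1 + D.1 = B.1 + C.1 → A.2 + D.2 = B.2 + C.2 →
      tileRegion (rhombus (i, j) u) = convexHull ℝ (gridPoint '' tileVertices (rhombus (i, j) u)) := by
    intro u A B C D hup hdown h1 h2
    have e1 : ((UnitTriangle.up u.1 u.2).vertices : Set (ℕ × ℕ)) = {A, B, C} := by
      ext v
      simpa using hup v
    have e2 : ((UnitTriangle.down i j).vertices : Set (ℕ × ℕ)) = {D, B, C} := by
      ext v
      simpa using hdown v
    have e3 : tileVertices (rhombus (i, j) u) = {A, B, C, D} := by
      ext v
      rw [mem_tileVertices_rhombus, hup, hdown]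
      simp only [Set.mem_insert_iff, Set.mem_singleton_iff]
      tauto
    have h1' : (A.1 : ℝ) + D.1 = B.1 + C.1 := by exact_mod_cast h1
    have h2' : (A.2 : ℝ) + D.2 = B.2 + C.2 := by exact_mod_cast h2
    have hpar : gridPoint A + gridPoint D = gridPoint B + gridPoint C := by
      apply eq_of_coords <;> simpa
    rw [e3]
    simp only [Set.image_insert_eq, Set.image_singleton]
    rw [convexHull_parallelogram hpar, tileRegion, rhombus, Set.biUnion_insert,
      Set.biUnion_singleton, UnitTriangle.region, UnitTriangle.region, e1, e2]
    simp only [Set.image_insert_eq, Set.image_singleton]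
    exact Set.union_comm _ _
  rcases h with rfl | rfl | rfl
  · exact key _ (i, j) (i + 1, j) (i, j + 1) (i + 1, j + 1) (by simp [UnitTriangle.vertices])
      (by simp [UnitTriangle.vertices]; tauto) (by dsimp only; omega) rfl
  · exact key _ (i, j + 2) (i, j + 1) (i + 1, j + 1) (i + 1, j)
      (by simp [UnitTriangle.vertices]; tauto) (by simp [UnitTriangle.vertices])
      rfl (by dsimp only; omega)
  · exact key _ (i + 2, j) (i + 1, j) (i + 1, j + 1) (i, j + 1)
      (by simp [UnitTriangle.vertices]; tauto) (by simp [UnitTriangle.vertices]; tauto)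
      (by dsimp only; omega) rfl

theorem tileRegion_singleton (t : UnitTriangle) :
    tileRegion {t} = convexHull ℝ (gridPoint '' tileVertices {t}) := by
  simp [tileRegion, tileVertices, UnitTriangle.region]

/-- A height function on the grid whose rhombus differences vanish exactly at the rhombi of the
tiling is supported, on each tile, by an affine function that is tight only at the tile. -/
theorem exists_support {n : ℕ} {S : Set UnitTriangle} {m : ℕ × ℕ → ℕ × ℕ}
    (hm : IsMatching n S m) {f : ℕ → ℕ → ℝ}
    (hf : ∀ i j, i + j + 2 ≤ n →
      (0 ≤ f i j + f (i + 1) (j + 1) - f (i + 1) j - f i (j + 1) ∧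
        (f i j + f (i + 1) (j + 1) - f (i + 1) j - f i (j + 1) = 0 ↔ m (i, j) = (i, j))) ∧
      (0 ≤ f i (j + 2) + f (i + 1) j - f i (j + 1) - f (i + 1) (j + 1) ∧
        (f i (j + 2) + f (i + 1) j - f i (j + 1) - f (i + 1) (j + 1) = 0 ↔
          m (i, j) = (i, j + 1))) ∧
      (0 ≤ f (i + 2) j + f i (j + 1) - f (i + 1) j - f (i + 1) (j + 1) ∧
        (f (i + 2) j + f i (j + 1) - f (i + 1) j - f (i + 1) (j + 1) = 0 ↔
          m (i, j) = (i + 1, j))))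
    {a b : ℕ} (hab : a + b + 1 ≤ n) {c : Set UnitTriangle} (hc : c ∈ tiling n S m)
    (habc : UnitTriangle.up a b ∈ c) :
    ∃ (l : Plane →ₗ[ℝ] ℝ) (μ : ℝ), ∀ v ∈ {v : ℕ × ℕ | v.1 + v.2 ≤ n},
      μ ≤ l (gridPoint v) + f v.1 v.2 ∧
      (l (gridPoint v) + f v.1 v.2 = μ ↔ v ∈ tileVertices c) := by
  -- The affine function interpolating `f` at the vertices of `up a b` is subtracted. This leaves
  -- the rhombus differences unchanged, and no two vanish at one down triangle since it has only one
  -- partner. The third argument of `g` is a dummy.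
  set β := f (a + 1) b - f a b with hβ
  set γ := f a (b + 1) - f a b with hγ
  set g : ℕ → ℕ → ℕ → ℝ := fun i j _ => f i j - (f a b + β * (i - a) + γ * (j - b)) with hg
  have hhive : IsHive n g := by
    intro i j k hijk
    obtain ⟨⟨s1, s2⟩, ⟨h1, h2⟩, ⟨v1, v2⟩⟩ := hf i j (by omega)
    have eS : rhombusDiff g i j k = f i j + f (i + 1) (j + 1) - f (i + 1) j - f i (j + 1) := by
      simp only [rhombusDiff, hg]
      push_cast
      ring
    have eH : rhombusDiff₂ g i j k
        = f i (j + 2) + f (i + 1) j - f i (j + 1) - f (i + 1) (j + 1) := by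
      simp only [rhombusDiff₂, hg]
      push_cast
      ring
    have eV : rhombusDiff₁ g i j k
        = f (i + 2) j + f i (j + 1) - f (i + 1) j - f (i + 1) (j + 1) := by
      simp only [rhombusDiff₁, hg]
      push_cast
      ring
    rw [eS, eH, eV]
    have pos : ∀ {x y : ℝ}, 0 ≤ x → 0 ≤ y → ¬ (x = 0 ∧ y = 0) → 0 < x + y := by
      intro x y hx hy hxy
      refine (add_nonneg hx hy).lt_of_ne fun h => hxy ?_
      constructor <;> linarith
    refine ⟨⟨s1, h1, v1⟩, pos s1 h1 ?_, pos h1 v1 ?_, pos v1 s1 ?_⟩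
    · rw [s2, h2]
      rintro ⟨k1, k2⟩
      simp [k1] at k2
    · rw [h2, v2]
      rintro ⟨k1, k2⟩
      simp [k1] at k2
    · rw [v2, s2]
      rintro ⟨k1, k2⟩
      simp [k1] at k2
  have hmain := fun v (hv : v ∈ {v : ℕ × ℕ | v.1 + v.2 ≤ n}) => hhive.nonneg
    (a := a) (b := b) (c := n - a - b - 1) (by omega) (by simp [hg]) (by simp [hg, hβ])
    (by simp [hg, hγ]) (x := v.1) (y := v.2) (z := n - v.1 - v.2)
    (by have : v.1 + v.2 ≤ n := hv; omega)
  -- By `IsHive.nonneg` any zero outside `up a b` is the mirror image of a vertex in a side. Such a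
  -- zero means a vanishing rhombus difference, so this side is the short diagonal of the rhombus
  -- containing `up a b`.
  have htile : ∀ v ∈ {v : ℕ × ℕ | v.1 + v.2 ≤ n}, v ∈ tileVertices c ↔ g v.1 v.2 0 = 0 := by
    have eA : g a b 0 = 0 := by simp [hg]
    have eB : g (a + 1) b 0 = 0 := by simp [hg, hβ]
    have eC : g a (b + 1) 0 = 0 := by simp [hg, hγ]
    have hmc : ∀ p : ℕ × ℕ, p.1 + p.2 + 2 ≤ n → m p = (a, b) → c = rhombus p (a, b) := by
      intro p hp hpm
      rcases hc with ⟨t, ht, rfl⟩ | ⟨q, hq, rfl⟩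
      · rw [← Set.mem_singleton_iff.1 habc] at ht
        have := hm.notMem p hp
        rw [hpm] at this
        exact absurd ht this
      · simp only [rhombus, Set.mem_insert_iff, reduceCtorEq, Set.mem_singleton_iff,
          false_or, UnitTriangle.up.injEq] at habc
        have hmq : m q = (a, b) := (Prod.ext habc.1 habc.2).symm
        rw [hm.inj q p hq hp (hmq.trans hpm.symm), hpm]
    have hupc : ∀ v ∈ (UnitTriangle.up a b).vertices, v ∈ tileVertices c := fun v hv =>
      Set.mem_biUnion habc hv
    rintro ⟨x, y⟩ hv
    have hxy : x + y ≤ n := hv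
    constructor
    · intro hvc
      have hup : (x, y) ∈ (UnitTriangle.up a b).vertices → g x y 0 = 0 := by
        intro h
        simp only [UnitTriangle.vertices, Finset.mem_insert, Finset.mem_singleton,
          Prod.mk.injEq] at h
        rcases h with ⟨rfl, rfl⟩ | ⟨rfl, rfl⟩ | ⟨rfl, rfl⟩ <;> assumption
      rcases hc with ⟨t, ht, rfl⟩ | ⟨⟨i, j⟩, hq, rfl⟩
      · rw [← Set.mem_singleton_iff.1 habc] at hvc
        exact hup (mem_tileVertices_singleton.1 hvc)
      · simp only [rhombus, Set.mem_insert_iff, reduceCtorEq, Set.mem_singleton_iff,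
          false_or, UnitTriangle.up.injEq] at habc
        have hmq : m (i, j) = (a, b) := (Prod.ext habc.1 habc.2).symm
        rw [hmq, mem_tileVertices_rhombus] at hvc
        rcases hvc with hvc | hvc
        · obtain ⟨⟨-, s2⟩, ⟨-, h2⟩, ⟨-, v2⟩⟩ := hf i j hq
          simp only [UnitTriangle.vertices, Finset.mem_insert, Finset.mem_singleton,
            Prod.mk.injEq] at hvc
          rcases hm.adjacent _ hq with h | h | h <;> rw [hmq, Prod.mk.injEq] at h <;>
            obtain ⟨rfl, rfl⟩ := h
          · have := s2.2 hmq
            simp only [hg] at *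
            rcases hvc with ⟨rfl, rfl⟩ | ⟨rfl, rfl⟩ | ⟨rfl, rfl⟩
            · exact eB
            · exact eC
            · push_cast
              linarith
          · have := h2.2 hmq
            simp only [hg] at *
            rcases hvc with ⟨rfl, rfl⟩ | ⟨rfl, rfl⟩ | ⟨rfl, rfl⟩
            · push_cast
              linarith
            · exact eA
            · exact eB
          · have := v2.2 hmq
            simp only [hg] at *
            rcases hvc with ⟨rfl, rfl⟩ | ⟨rfl, rfl⟩ | ⟨rfl, rfl⟩
            · exact eA
            · push_cast
              linarith
            · exact eC
        · exact hup hvc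
    · intro h0
      rcases (hmain (x, y) hv).2 h0 with ⟨h1, h2⟩ | ⟨h1, h2⟩ | ⟨h1, h2⟩ | ⟨h1, h2⟩ |
        ⟨h1, h2⟩ | ⟨h1, h2⟩ <;> simp only at h1 h2
      · exact hupc _ (by simp [UnitTriangle.vertices, h1, h2])
      · exact hupc _ (by simp [UnitTriangle.vertices, h1, h2])
      · exact hupc _ (by simp [UnitTriangle.vertices, h1, h2])
      · subst h1 h2
        have hz : f a b + f (a + 1) (b + 1) - f (a + 1) b - f a (b + 1) = 0 := by
          simp only [hg] at h0
          push_cast at h0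
          linarith
        rw [hmc (a, b) (by simp only; omega) ((hf a b (by omega)).1.2.1 hz),
          mem_tileVertices_rhombus]
        simp [UnitTriangle.vertices]
      · subst h1 h2
        have hz : f a (y + 2) + f (a + 1) y - f a (y + 1) - f (a + 1) (y + 1) = 0 := by
          simp only [hg] at h0
          push_cast at h0
          linarith
        rw [hmc (a, y) (by simp only; omega) ((hf a y (by omega)).2.1.2.1 hz),
          mem_tileVertices_rhombus]
        simp [UnitTriangle.vertices]
      · subst h1 h2
        have hz : f (x + 2) b + f x (b + 1) - f (x + 1) b - f (x + 1) (b + 1) = 0 := by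
          simp only [hg] at h0
          push_cast at h0
          linarith
        rw [hmc (x, b) (by simp only; omega) ((hf x b (by omega)).2.2.2.1 hz),
          mem_tileVertices_rhombus]
        simp [UnitTriangle.vertices]
  refine ⟨-(β • coordX + γ • coordY), f a b - β * a - γ * b, fun v hv => ?_⟩
  have hval : (-(β • coordX + γ • coordY)) (gridPoint v) + f v.1 v.2
      = g v.1 v.2 0 + (f a b - β * a - γ * b) := by
    simp only [LinearMap.neg_apply, LinearMap.add_apply, LinearMap.smul_apply, coordX_gridPoint,
      coordY_gridPoint, smul_eq_mul, hg]
    ring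
  have h1 := (hmain v hv).1
  rw [hval, htile v hv]
  refine ⟨by simp only [hg] at h1 ⊢; linarith, by constructor <;> intro h <;> linarith⟩

/-- A fine mixed subdivision that is determined by its holes is regular. -/
theorem IsFineMixedSubdivision.isRegular_of_unique {n : ℕ} {S : Set UnitTriangle}
    (hS : IsHoleArrangement n S) {C : Set (Set UnitTriangle)} (hC : IsFineMixedSubdivision n C)
    (hholes : holes C = S)
    (hunique : ∀ C' : Set (Set UnitTriangle),
      IsFineMixedSubdivision n C' → holes C' = S → C' = C) :
    IsRegular (upwardTriangle 0 0 n) (tileRegion '' C) := by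
  obtain ⟨m, hm, hCm⟩ := hC.exists_matching hholes
  obtain ⟨s, h, v, hval, hbx, hby⟩ := exists_balanced_weights n (fun i j => m (i, j) = (i, j))
    (fun i j => m (i, j) = (i, j + 1)) (fun i j => m (i, j) = (i + 1, j))
    (eq_zero_of_not_contracting hS hC hunique hm hCm)
  obtain ⟨f, hf⟩ := exists_rhombus_differences n s h v hbx hby
  have hf' : ∀ i j, i + j + 2 ≤ n → _ := fun i j hij => by
    have := hval i j hij
    rw [← (hf i j hij).1, ← (hf i j hij).2.1, ← (hf i j hij).2.2] at this
    exact this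
  -- The up triangle in each tile provides both its support function and its nonempty interior.
  have hup : ∀ c ∈ C, ∃ a b, a + b + 1 ≤ n ∧ UnitTriangle.up a b ∈ c := by
    intro c hc
    have hin := hC.inside c hc
    rcases hC.tile c hc with ⟨⟨a, b⟩ | ⟨a, b⟩, ht, rfl⟩ | hr
    · exact ⟨a, b, inside_up.1 (hin _ rfl), rfl⟩
    · exact absurd ht id
    · obtain ⟨p, u, -, rfl⟩ := isRhombus_iff.1 hr
      have hmem : UnitTriangle.up u.1 u.2 ∈ rhombus p u :=
        Set.mem_insert_of_mem _ (Set.mem_singleton _)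
      exact ⟨u.1, u.2, inside_up.1 (hin _ hmem), hmem⟩
  have hregion : ∀ c ∈ C, tileRegion c = convexHull ℝ (gridPoint '' tileVertices c) := by
    intro c hc
    rcases hC.tile c hc with ⟨t, ht, rfl⟩ | hr
    · exact tileRegion_singleton t
    · obtain ⟨p, u, hpu, rfl⟩ := isRhombus_iff.1 hr
      exact tileRegion_rhombus hpu
  have hfin : {v : ℕ × ℕ | v.1 + v.2 ≤ n}.Finite := by
    refine ((Set.finite_Iic n).prod (Set.finite_Iic n)).subset fun p hp => ?_
    have : p.1 + p.2 ≤ n := hp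
    simp only [Set.mem_prod, Set.mem_Iic]
    omega
  have hreg := isRegular_of_supporting hfin gridPoint (fun v => f v.1 v.2) (tileVertices '' C)
    (by
      rintro _ ⟨c, hc, rfl⟩ v hv
      obtain ⟨t, ht, hvt⟩ := Set.mem_iUnion₂.1 hv
      have := (hC.inside c hc t ht v hvt).2.2
      simpa using this)
    (by
      rintro _ ⟨c, hc, rfl⟩
      obtain ⟨a, b, hab, habc⟩ := hup c hc
      exact exists_support hm hf' hab (hCm ▸ hc) habc)
    (by
      rintro _ ⟨c, hc, rfl⟩
      obtain ⟨a, b, hab, habc⟩ := hup c hc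
      exact (interior_region_up_nonempty a b).mono
        (interior_mono (region_subset_convexHull habc)))
    (by
      intro p hp
      obtain ⟨t, ht, hpt⟩ := exists_unitTriangle_of_mem_interior hp
      obtain ⟨c, ⟨hc, htc⟩, -⟩ := hC.partition t ht
      exact Set.mem_biUnion (Set.mem_image_of_mem _ hc) (region_subset_convexHull htc hpt))
  rw [convexHull_gridPoints, Set.image_image] at hreg
  rw [Set.image_congr hregion]
  exact hreg

end HoleyTriangle

theorem mainTheorem6 (n : ℕ) (S : Set HoleyTriangle.UnitTriangle)
    (hS : HoleyTriangle.IsHoleArrangement n S)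
    (hspread : HoleyTriangle.IsSpreadOut n S)
    (C : Set (Set HoleyTriangle.UnitTriangle))
    (hC : HoleyTriangle.IsFineMixedSubdivision n C)
    (hholes : HoleyTriangle.holes C = S)
    (hunique : ∀ C' : Set (Set HoleyTriangle.UnitTriangle),
      HoleyTriangle.IsFineMixedSubdivision n C' → HoleyTriangle.holes C' = S → C' = C) :
    HoleyTriangle.IsRegular (HoleyTriangle.upwardTriangle 0 0 n)
      (HoleyTriangle.tileRegion '' C) := by
  exact hC.isRegular_of_unique hS hholes hunique
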